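/- **Theorem 6.5.** *Setting.* Let $d\ge 1$, let $e_1,\dots,e_d$ be an orthonormal basis of $\mathbb C^d$, and let $\mathcal T=\mathbb C\oplus\mathbb C^d\oplus(\mathbb C^d)^{\otimes 2}\oplus\cdots$ be the full Fock space over $\mathbb C^d$, with vacuum vector $\xi_{\mathrm{vac}}$ (a unit vector of the first summand) and vacuum-state $\varphi_{\mathrm{vac}}(X)=\langle X\xi_{\mathrm{vac}},\xi_{\mathrm{vac}}\rangle$ on $B(\mathcal T)$. Let $L_i$ and $R_i$ be the left and right creation operators of $e_i$: $L_i(x)=e_i\otimes x$, $R_i(x)=x\otimes e_i$. Let $f=\sum_{n\ge1}\sum_{i_1,\dots,i_n=1}^d\alpha_{(i_1,\dots,i_n)}z_{i_1}\cdots z_{i_n}$ and $g=\sum_{n\ge1}\sum_{i_1,\dots,i_n=1}^d\beta_{(i_1,\dots,i_n)}z_{i_1}\cdots z_{i_n}$ be complex polynomials without constant term in non-commuting indeterminates $z_1,\dots,z_d$, and for $1\le i\le d$ put $$C_{i;\ell}=A_i=L_i^*\Bigl(I+\sum_{n\ge1}\sum_{i_1,\dots,i_n}\alpha_{(i_1,\dots,i_n)}L_{i_n}\cdots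 L_{i_1}\Bigr),\qquad C_{i;r}=B_i=R_i^*\Bigl(I+\sum_{n\ge1}\sum_{i_1,\dots,i_n}\beta_{(i_1,\dots,i_n)}R_{i_n}\cdots R_{i_1}\Bigr).$$ *The partitions.* Let $n\ge1$ and $\chi=(h_1,\dots,h_n)\in\{\ell,r\}^n$. Let $p_1,\dots,p_n\ge 0$ be integers with $p_1+\cdots+p_i\ge i$ for all $i$ and $p_1+\cdots+p_n=n$. Starting from an empty double-ended queue, at each time $i=1,\dots,n$ insert $p_i$ new balls into the queue at the end $h_i$ (the left end if $h_i=\ell$, the right end if $h_i=r$), and then remove the ball that is at that end. Two times $t,t'\in\{1,\dots,n\}$ are put in the same block when the balls removed at the times $t$ and $t'$ were inserted at the same time. This gives a partition of $\{1,\dots,n\}$; let $\mathcal P^{(\chi)}(n)$ be the set of all the partitions that arise in this way from $\chi$, as $(p_1,\dots,p_n)$ varies. *The cumulants.* For a unital complex algebra $\mathcal A$ and a linear functional $\varphi$ on $\mathcal A$ with $\varphi(1)=1$, the $(\ell,r)$-cumulant functionals of $(\mathcal A,\varphi)$ are the multilinear functionals $\kappa_\chi:\mathcal A^n\to\mathbb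 C$ ($n\ge1$, $\chi\in\{\ell,r\}^n$) that are uniquely determined by $$\varphi(a_1\cdots a_n)=\sum_{\pi\in\mathcal P^{(\chi)}(n)}\ \prod_{V\in\pi}\kappa_{\chi|V}\bigl((a_1,\dots,a_n)|V\bigr)\qquad\text{for all } n\ge1,\ \chi\in\{\ell,r\}^n,\ a_1,\dots,a_n\in\mathcal A,$$ where $(x_1,\dots,x_n)|V=(x_{j_1},\dots,x_{j_m})$ for $V=\{j_1<\cdots<j_m\}$. *Statement.* Let $(\kappa_\chi)$ be the $(\ell,r)$-cumulant functionals of $(B(\mathcal T),\varphi_{\mathrm{vac}})$. Let $n\ge1$ and $\chi=(h_1,\dots,h_n)\in\{\ell,r\}^n$, and let $m_\ell(1)<\cdots<m_\ell(u)$ and $m_r(1)<\cdots<m_r(v)$ be the positions at which $\ell$ and $r$, respectively, occur in $\chi$. Then for all $i_1,\dots,i_n\in\{1,\dots,d\}$, $$\kappa_\chi(C_{i_1;h_1},\dots,C_{i_n;h_n})=\begin{cases}\alpha_{(i_{m_r(v)},\dots,i_{m_r(1)},\,i_{m_\ell(1)},\dots,i_{m_\ell(u)})},&\text{if }h_n=\ell,\\[4pt]\beta_{(i_{m_\ell(u)},\dots,i_{m_\ell(1)},\,i_{m_r(1)},\dots,i_{m_r(v)})},&\text{if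 }h_n=r.\end{cases}$$ -/

import Mathlib

open scoped ENNReal

/-! ### Double-ended queues and the partitions they produce -/

/-- The two letters `ℓ` and `r`. -/
inductive Side where
  | left
  | right
deriving DecidableEq

namespace Deque

/-- Insert `p` balls, all of them carrying the tag `b`, into the deque pipe from the side `h`.
The list gives the tags of the balls in the deque pipe, read from left to right. -/
def insertBalls {β : Type*} (h : Side) (p : ℕ) (b : β) (D : List β) : List β :=
  match h with
  | Side.left => List.replicate p b ++ D
  | Side.right => D ++ List.replicate p b

/-- The ball at the end `h` of the deque pipe (`none` if the pipe is empty). -/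
def endBall {β : Type*} (h : Side) (D : List β) : Option β :=
  match h with
  | Side.left => D.head?
  | Side.right => D.getLast?

/-- The deque pipe after its ball at the end `h` has been taken out. -/
def removeEnd {β : Type*} (h : Side) (D : List β) : List β :=
  match h with
  | Side.left => D.tail
  | Side.right => D.dropLast

/-- The `n`-tuples `(p₁, …, pₙ)` that occur in deque-scenarios: `p₁ + ⋯ + pᵢ ≥ i` for all `i`, and
`p₁ + ⋯ + pₙ = n`. Equivalently, `(p₁ - 1, …, pₙ - 1)` is the rise-vector of a Lukasiewicz path
with `n` steps. -/
def IsScenario {n : ℕ} (p : Fin n → ℕ) : Prop :=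
  (∀ i : Fin n, (i : ℕ) + 1 ≤ ∑ j ∈ Finset.Iic i, p j) ∧ ∑ j, p j = n

/-- The content of the deque pipe after the first `t` moves of the scenario with array `(p, χ)`.
The `i`-th move inserts `p i` balls from the side `χ i` and then moves the ball at the end `χ i` of
the deque pipe into the output pipe. Each ball carries as a tag the index of the move in which it
left the input pipe. -/
def content {n : ℕ} (p : Fin n → ℕ) (χ : Fin n → Side) : (t : ℕ) → t ≤ n → List (Fin n)
  | 0, _ => []
  | t + 1, ht =>
      removeEnd (χ ⟨t, ht⟩)
        (insertBalls (χ ⟨t, ht⟩) (p ⟨t, ht⟩) ⟨t, ht⟩ (content p χ t (Nat.le_of_succ_le ht)))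

/-- The tag of the ball that arrives in the output pipe in the move `i`: the index of the move in
which this ball left the input pipe. -/
def outputTag {n : ℕ} (p : Fin n → ℕ) (χ : Fin n → Side) (i : Fin n) : Option (Fin n) :=
  endBall (χ i) (insertBalls (χ i) (p i) i (content p χ i i.isLt.le))

open scoped Classical in
/-- The output-time partition of a deque-scenario: two output times are in the same block when the
balls arriving in the output pipe at these times left the input pipe in the same move. -/
noncomputable def outputTimePartition {n : ℕ} (p : Fin n → ℕ) (χ : Fin n → Side) :
    Finpartition (Finset.univ : Finset (Fin n)) :=
  Finpartition.ofSetoid (Setoid.ker (outputTag p χ))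

open scoped Classical in
/-- The set `P^(χ)(n)` of the output-time partitions of all deque-scenarios compatible with `χ`. -/
noncomputable def partitions {n : ℕ} (χ : Fin n → Side) :
    Finset (Finpartition (Finset.univ : Finset (Fin n))) :=
  {π | ∃ p : Fin n → ℕ, IsScenario p ∧ outputTimePartition p χ = π}

end Deque

/-! ### `(ℓ, r)`-cumulant functionals of a noncommutative probability space -/

namespace LRCumulant

/-- The restriction `(x₁, …, xₙ) | V` of a tuple to a subset `V` of its set of indices. -/
def restrict {X : Type*} {n : ℕ} (x : Fin n → X) (V : Finset (Fin n)) : Fin V.card → X :=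
  fun k => x (V.orderEmbOfFin rfl k)

theorem restrict_update_of_notMem {X : Type*} {n : ℕ} (x : Fin n → X) (V : Finset (Fin n))
    (k : Fin n) (hk : k ∉ V) (y : X) : restrict (Function.update x k y) V = restrict x V := by
  funext j
  have : V.orderEmbOfFin rfl j ≠ k := fun h => hk (h ▸ V.orderEmbOfFin_mem rfl j)
  simp [restrict, this]

theorem restrict_update_of_mem {X : Type*} {n : ℕ} (x : Fin n → X) (V : Finset (Fin n))
    (k : Fin n) (hk : k ∈ V) :
    ∃ j : Fin V.card, ∀ y : X,
      restrict (Function.update x k y) V = Function.update (restrict x V) j y := by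
  have : k ∈ Set.range (V.orderEmbOfFin rfl) := by
    rw [Finset.range_orderEmbOfFin]; exact hk
  obtain ⟨j, rfl⟩ := this
  refine ⟨j, fun y => ?_⟩
  funext l
  by_cases h : l = j
  · subst h; simp [restrict]
  · have : V.orderEmbOfFin rfl l ≠ V.orderEmbOfFin rfl j := by simpa using h
    simp [restrict, h]

variable {A : Type*} [Ring A] [Algebra ℂ A]

theorem prod_blocks_update {n : ℕ} (π : Finpartition (Finset.univ : Finset (Fin n)))
    (K : (V : Finset (Fin n)) → MultilinearMap ℂ (fun _ : Fin V.card => A) ℂ)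
    (a : Fin n → A) (k : Fin n) :
    ∃ (c : ℂ) (V : Finset (Fin n)) (j : Fin V.card), ∀ y : A,
      ∏ W ∈ π.parts, K W (restrict (Function.update a k y) W) =
        K V (Function.update (restrict a V) j y) * c := by
  classical
  have hV : π.part k ∈ π.parts := π.part_mem.2 (Finset.mem_univ k)
  have hk : k ∈ π.part k := π.mem_part (Finset.mem_univ k)
  obtain ⟨j, hj⟩ := restrict_update_of_mem a (π.part k) k hk
  refine ⟨∏ W ∈ π.parts.erase (π.part k), K W (restrict a W), π.part k, j, fun y => ?_⟩
  rw [← Finset.mul_prod_erase _ _ hV, hj]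
  congr 1
  refine Finset.prod_congr rfl fun W hW => ?_
  rw [restrict_update_of_notMem]
  intro hkW
  obtain ⟨h1, h2⟩ := Finset.mem_erase.1 hW
  exact h1 (π.part_eq_of_mem h2 hkW).symm

/-- The multilinear functional `(a₁, …, aₙ) ↦ ∏ K_V ((a₁, …, aₙ) | V)`, with the product over the
blocks `V` of the partition `π`. -/
def blockProd {n : ℕ} (π : Finpartition (Finset.univ : Finset (Fin n)))
    (K : (V : Finset (Fin n)) → MultilinearMap ℂ (fun _ : Fin V.card => A) ℂ) :
    MultilinearMap ℂ (fun _ : Fin n => A) ℂ :=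
  MultilinearMap.mk' (fun a => ∏ V ∈ π.parts, K V (restrict a V))
    (fun a k x y => by
      obtain ⟨c, V, j, h⟩ := prod_blocks_update π K a k
      simp only [h, MultilinearMap.map_update_add, add_mul])
    (fun a k t x => by
      obtain ⟨c, V, j, h⟩ := prod_blocks_update π K a k
      simp only [h, MultilinearMap.map_update_smul, smul_eq_mul, mul_assoc])

@[simp]
theorem blockProd_apply {n : ℕ} (π : Finpartition (Finset.univ : Finset (Fin n)))
    (K : (V : Finset (Fin n)) → MultilinearMap ℂ (fun _ : Fin V.card => A) ℂ) (a : Fin n → A) :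
    blockProd π K a = ∏ V ∈ π.parts, K V (restrict a V) := rfl

/-- The moment functional `(a₁, …, aₙ) ↦ φ (a₁ ⋯ aₙ)`. -/
noncomputable def moment (φ : A →ₗ[ℂ] ℂ) (n : ℕ) : MultilinearMap ℂ (fun _ : Fin n => A) ℂ :=
  φ.compMultilinearMap (MultilinearMap.mkPiAlgebraFin ℂ n A)

@[simp]
theorem moment_apply (φ : A →ₗ[ℂ] ℂ) (n : ℕ) (a : Fin n → A) :
    moment φ n a = φ (List.ofFn a).prod := by
  simp [moment]

/-- The requirement that determines the `(ℓ, r)`-cumulant functionals of `(A, φ)`: for all `n ≥ 1`,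
all `χ` in `{ℓ, r}^n` and all `a₁, …, aₙ` in `A`, one has
`φ (a₁ ⋯ aₙ) = ∑ ∏ κ_{χ | V} ((a₁, …, aₙ) | V)`, with the sum over the partitions `π` in `P^(χ)(n)`
and the product over the blocks `V` of `π`. -/
def IsCumulantFamily (φ : A →ₗ[ℂ] ℂ)
    (κ : (n : ℕ) → (Fin n → Side) → MultilinearMap ℂ (fun _ : Fin n => A) ℂ) : Prop :=
  ∀ (n : ℕ), 1 ≤ n → ∀ (χ : Fin n → Side) (a : Fin n → A),
    φ (List.ofFn a).prod =
      ∑ π ∈ Deque.partitions χ, ∏ V ∈ π.parts, κ V.card (restrict χ V) (restrict a V)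

/-- The `(ℓ, r)`-cumulant functionals `κ_χ : A^n → ℂ` of `(A, φ)`, constructed by recursion on `n`.
By `isCumulantFamily_cumulant` and `IsCumulantFamily.eq_cumulant` this is, for `n ≥ 1`, the only
family that satisfies `IsCumulantFamily φ`. -/
noncomputable def cumulant (φ : A →ₗ[ℂ] ℂ) :
    (n : ℕ) → (Fin n → Side) → MultilinearMap ℂ (fun _ : Fin n => A) ℂ
  | n, χ =>
      moment φ n -
        ∑ π ∈ (Deque.partitions χ).filter (fun π => π.parts ≠ {Finset.univ}),
          blockProd π (fun V =>
            if _h : V.card < n then cumulant φ V.card (restrict χ V) else 0)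
  termination_by n => n

/-- The partition with one block arises from the scenario in which the first move inserts all the
balls. -/
theorem exists_oneBlock_mem {n : ℕ} (hn : 1 ≤ n) (χ : Fin n → Side) :
    ∃ π ∈ Deque.partitions χ, π.parts = {Finset.univ} := by
  classical
  set z : Fin n := ⟨0, hn⟩ with hz
  set p : Fin n → ℕ := fun i => if i = z then n else 0 with hp
  have hcont : ∀ (t : ℕ) (ht : t ≤ n), 1 ≤ t →
      Deque.content p χ t ht = List.replicate (n - t) z := by
    intro t
    induction t with
    | zero => intro _ h; omega
    | succ t ih =>
      intro ht _
      rw [Deque.content]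
      by_cases h0 : t = 0
      · subst h0
        have : p ⟨0, ht⟩ = n := by simp [hp, hz]
        rw [this]
        cases χ ⟨0, ht⟩ <;>
          simp [Deque.content, Deque.insertBalls, Deque.removeEnd, hz]
      · have : p ⟨t, ht⟩ = 0 := by simp [hp, hz, Fin.ext_iff, h0]
        rw [this, ih _ (by omega)]
        have e : n - t - 1 = n - (t + 1) := by omega
        cases χ ⟨t, ht⟩ <;>
          simp [Deque.insertBalls, Deque.removeEnd, e]
  have htag : ∀ i : Fin n, Deque.outputTag p χ i = some z := by
    intro i
    unfold Deque.outputTag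
    by_cases h0 : (i : ℕ) = 0
    · have hi : i = z := Fin.ext h0
      subst hi
      have : p z = n := by simp [hp]
      rw [this]
      have hne : n ≠ 0 := by omega
      have hc : Deque.content p χ (z : ℕ) z.isLt.le = [] := by
        simp [hz, Deque.content]
      rw [hc]
      cases χ z <;>
        simp [Deque.insertBalls, Deque.endBall, List.head?_replicate, List.getLast?_replicate, hne]
    · have : p i = 0 := by simp [hp, hz, Fin.ext_iff, h0]
      rw [this, hcont i _ (by omega)]
      have hne : n - (i : ℕ) ≠ 0 := by omega
      cases χ i <;>
        simp [Deque.insertBalls, Deque.endBall, List.head?_replicate, List.getLast?_replicate, hne]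
  have hscen : Deque.IsScenario p := by
    refine ⟨fun i => ?_, by simp [hp]⟩
    have hzi : z ∈ Finset.Iic i := by simp [hz, Fin.le_def]
    have := Finset.single_le_sum (f := p) (fun _ _ => Nat.zero_le _) hzi
    have hpz : p z = n := by simp [hp]
    omega
  refine ⟨Deque.outputTimePartition p χ, ?_, ?_⟩
  · simp only [Deque.partitions, Finset.mem_filter, Finset.mem_univ, true_and]
    exact ⟨p, hscen, rfl⟩
  · have hpart : ∀ i : Fin n, (Deque.outputTimePartition p χ).part i = Finset.univ := by
      intro i
      ext j
      rw [Deque.outputTimePartition, Finpartition.mem_part_ofSetoid_iff_rel]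
      simp [Setoid.ker_def, htag]
    ext V
    simp only [Finset.mem_singleton]
    constructor
    · intro hV
      obtain ⟨i, hi⟩ := (Deque.outputTimePartition p χ).nonempty_of_mem_parts hV
      rw [← hpart i, (Deque.outputTimePartition p χ).part_eq_of_mem hV hi]
    · rintro rfl
      have hm := (Deque.outputTimePartition p χ).part_mem.2 (Finset.mem_univ z)
      rwa [hpart z] at hm

theorem card_lt_of_mem_parts {n : ℕ} {π : Finpartition (Finset.univ : Finset (Fin n))}
    (hπ : π.parts ≠ {Finset.univ}) {V : Finset (Fin n)} (hV : V ∈ π.parts) : V.card < n := by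
  classical
  have hne : V ≠ Finset.univ := by
    rintro rfl
    apply hπ
    ext W
    simp only [Finset.mem_singleton]
    constructor
    · intro hW
      obtain ⟨i, hi⟩ := π.nonempty_of_mem_parts hW
      exact π.eq_of_mem_parts hW hV hi (Finset.mem_univ i)
    · rintro rfl
      exact hV
  simpa using Finset.card_lt_card (Finset.ssubset_univ_iff.2 hne)

theorem family_univ {X : Type*} {n : ℕ}
    (κ : (n : ℕ) → (Fin n → Side) → (Fin n → X) → ℂ) (χ : Fin n → Side) (a : Fin n → X) :
    κ (Finset.univ : Finset (Fin n)).card (restrict χ Finset.univ) (restrict a Finset.univ) =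
      κ n χ a := by
  have key : ∀ (m : ℕ) (h : (Finset.univ : Finset (Fin n)).card = m) (hm : m = n),
      κ (Finset.univ : Finset (Fin n)).card (restrict χ Finset.univ) (restrict a Finset.univ) =
        κ m (fun k => χ ((Finset.univ : Finset (Fin n)).orderEmbOfFin h k))
          (fun k => a ((Finset.univ : Finset (Fin n)).orderEmbOfFin h k)) := by
    intro m h _
    subst h
    rfl
  have hc : (Finset.univ : Finset (Fin n)).card = n := by simp
  rw [key n hc rfl]
  have : ∀ k : Fin n, (Finset.univ : Finset (Fin n)).orderEmbOfFin hc k = k := by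
    intro k
    have := Finset.orderEmbOfFin_unique (s := (Finset.univ : Finset (Fin n))) hc
      (f := id) (fun _ => Finset.mem_univ _) strictMono_id
    exact (congrFun this k).symm
  simp only [this]

/-- In the moment formula, the term of the partition with one block is `κ_χ (a₁, …, aₙ)`. -/
theorem sum_partitions_eq {n : ℕ} (hn : 1 ≤ n)
    (κ : (n : ℕ) → (Fin n → Side) → MultilinearMap ℂ (fun _ : Fin n => A) ℂ)
    (χ : Fin n → Side) (a : Fin n → A) :
    ∑ π ∈ Deque.partitions χ, ∏ V ∈ π.parts, κ V.card (restrict χ V) (restrict a V) =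
      κ n χ a +
        ∑ π ∈ (Deque.partitions χ).filter (fun π => π.parts ≠ {Finset.univ}),
          ∏ V ∈ π.parts, κ V.card (restrict χ V) (restrict a V) := by
  classical
  obtain ⟨π₁, h1, h2⟩ := exists_oneBlock_mem hn χ
  rw [← Finset.add_sum_erase _ _ h1, h2, Finset.prod_singleton]
  congr 1
  · exact family_univ (fun n χ a => κ n χ a) χ a
  · refine Finset.sum_congr ?_ fun _ _ => rfl
    ext π
    simp only [Finset.mem_erase, Finset.mem_filter]
    constructor
    · rintro ⟨h, h'⟩
      exact ⟨h', fun h'' => h (Finpartition.ext (h''.trans h2.symm))⟩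
    · rintro ⟨h', h⟩
      exact ⟨fun h'' => h (h'' ▸ h2), h'⟩

theorem cumulant_apply (φ : A →ₗ[ℂ] ℂ) (n : ℕ) (χ : Fin n → Side) (a : Fin n → A) :
    cumulant φ n χ a = φ (List.ofFn a).prod -
      ∑ π ∈ (Deque.partitions χ).filter (fun π => π.parts ≠ {Finset.univ}),
        ∏ V ∈ π.parts, cumulant φ V.card (restrict χ V) (restrict a V) := by
  rw [cumulant]
  simp only [_root_.sub_apply, moment_apply, _root_.sum_apply, blockProd_apply]
  congr 1
  refine Finset.sum_congr rfl fun π hπ => Finset.prod_congr rfl fun V hV => ?_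
  rw [dif_pos (card_lt_of_mem_parts (Finset.mem_filter.1 hπ).2 hV)]

/-- The functionals `cumulant φ` satisfy the moment formula. -/
theorem isCumulantFamily_cumulant (φ : A →ₗ[ℂ] ℂ) : IsCumulantFamily φ (cumulant φ) := by
  intro n hn χ a
  rw [sum_partitions_eq hn, cumulant_apply]
  ring

/-- The moment formula determines the functionals uniquely. -/
theorem IsCumulantFamily.eq_cumulant {φ : A →ₗ[ℂ] ℂ}
    {κ : (n : ℕ) → (Fin n → Side) → MultilinearMap ℂ (fun _ : Fin n => A) ℂ}
    (hκ : IsCumulantFamily φ κ) (n : ℕ) (hn : 1 ≤ n) (χ : Fin n → Side) :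
    κ n χ = cumulant φ n χ := by
  induction n using Nat.strong_induction_on with
  | _ n ih =>
    ext a
    rw [cumulant_apply, hκ n hn χ a, sum_partitions_eq hn]
    rw [eq_sub_iff_add_eq, add_right_inj]
    refine Finset.sum_congr rfl fun π hπ => Finset.prod_congr rfl fun V hV => ?_
    rw [ih V.card (card_lt_of_mem_parts (Finset.mem_filter.1 hπ).2 hV)
      (Finset.card_pos.2 (π.nonempty_of_mem_parts hV))]

end LRCumulant

/-! ### The full Fock space and its canonical operators -/

namespace Fock

/-- The full Fock space over `ℂ^d`, in coordinates: the `n`-th tensor power of `ℂ^d` is the space of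
the `ℂ`-valued functions on the words of length `n` over `{1, …, d}` (the tensor
`v₁ ⊗ ⋯ ⊗ vₙ` being the function `(j₁, …, jₙ) ↦ v₁ j₁ ⋯ vₙ jₙ`), and the Hilbert direct sum of these
spaces is the space of the square-summable functions on the set of all words. -/
abbrev Space (d : ℕ) : Type := lp (fun _ : List (Fin d) => ℂ) 2

theorem memℓp_extend {d : ℕ} {u : List (Fin d) → List (Fin d)} (hu : Function.Injective u)
    (x : Space d) :
    Memℓp (E := fun _ : List (Fin d) => ℂ) (Function.extend u (x : List (Fin d) → ℂ) 0) 2 := by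
  have h2 : (0 : ℝ) < (2 : ℝ≥0∞).toReal := by norm_num
  rw [memℓp_gen_iff h2]
  have hx := (memℓp_gen_iff h2).1 (lp.memℓp x)
  refine (hu.summable_iff ?_).1 ?_
  · intro w hw
    rw [Function.extend_apply' _ _ _ (by simpa using hw)]
    simp
  · simpa [Function.comp_def, hu.extend_apply] using hx

/-- The isometry of the Fock space that relabels the words by an injective map `u`. -/
noncomputable def relabel {d : ℕ} (u : List (Fin d) → List (Fin d)) (hu : Function.Injective u) :
    Space d →ₗᵢ[ℂ] Space d where
  toFun x := ⟨Function.extend u (x : List (Fin d) → ℂ) 0, memℓp_extend hu x⟩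
  map_add' x y := by
    ext w
    change Function.extend u (⇑x + ⇑y) 0 w = Function.extend u ⇑x 0 w + Function.extend u ⇑y 0 w
    by_cases hw : ∃ w', u w' = w
    · obtain ⟨w', rfl⟩ := hw
      simp only [hu.extend_apply]
      rfl
    · simp [Function.extend_apply' _ _ _ hw]
  map_smul' c x := by
    ext w
    change Function.extend u (c • ⇑x) 0 w = c • Function.extend u ⇑x 0 w
    by_cases hw : ∃ w', u w' = w
    · obtain ⟨w', rfl⟩ := hw
      simp only [hu.extend_apply]
      rfl
    · simp [Function.extend_apply' _ _ _ hw]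
  norm_map' x := by
    have h2 : (0 : ℝ) < (2 : ℝ≥0∞).toReal := by norm_num
    rw [lp.norm_eq_tsum_rpow h2, lp.norm_eq_tsum_rpow h2]
    congr 1
    rw [← hu.tsum_eq]
    · simp [hu.extend_apply]
    · intro w hw
      by_contra hw'
      apply hw
      simp [Function.extend_apply' _ _ _ (by simpa using hw')]

theorem relabel_apply {d : ℕ} {u : List (Fin d) → List (Fin d)} (hu : Function.Injective u)
    (x : Space d) (w : List (Fin d)) : relabel u hu x (u w) = x w :=
  hu.extend_apply _ _ _

theorem relabel_apply_of_notMem {d : ℕ} {u : List (Fin d) → List (Fin d)}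
    (hu : Function.Injective u) (x : Space d) (w : List (Fin d)) (hw : ¬ ∃ w', u w' = w) :
    relabel u hu x w = 0 :=
  Function.extend_apply' _ _ _ hw

/-- The vacuum vector. -/
noncomputable def vacuum (d : ℕ) : Space d := lp.single 2 [] 1

/-- The vacuum-state `X ↦ ⟨X ξ, ξ⟩` on the bounded operators (Mathlib's inner product is linear in
the second variable). -/
noncomputable def vacuumState (d : ℕ) : (Space d →L[ℂ] Space d) →ₗ[ℂ] ℂ where
  toFun X := inner ℂ (vacuum d) (X (vacuum d))
  map_add' X Y := by simp
  map_smul' c X := by simp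

/-- The left-creation operator `x ↦ v ⊗ x` defined by a vector `v` of `ℂ^d`. -/
noncomputable def leftCreation {d : ℕ} (v : EuclideanSpace ℂ (Fin d)) : Space d →L[ℂ] Space d :=
  ∑ j, v j • (relabel (fun w => j :: w) (List.cons_injective)).toContinuousLinearMap

/-- The right-creation operator `x ↦ x ⊗ v` defined by a vector `v` of `ℂ^d`. -/
noncomputable def rightCreation {d : ℕ} (v : EuclideanSpace ℂ (Fin d)) : Space d →L[ℂ] Space d :=
  ∑ j, v j • (relabel (fun w => w ++ [j]) (List.append_left_injective [j])).toContinuousLinearMap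

theorem sum_smul_apply {d : ℕ} (v : EuclideanSpace ℂ (Fin d)) (F : Fin d → (Space d →ₗᵢ[ℂ] Space d))
    (x : Space d) (w : List (Fin d)) :
    (∑ j, v j • (F j).toContinuousLinearMap : Space d →L[ℂ] Space d) x w =
      ∑ j, v j * F j x w := by
  have h1 : (∑ j, v j • (F j).toContinuousLinearMap : Space d →L[ℂ] Space d) x =
      ∑ j, v j • F j x := by simp
  rw [h1]
  change lp.evalₗ (𝕜 := ℂ) (fun _ : List (Fin d) => ℂ) 2 w _ = _
  rw [map_sum]
  rfl

theorem leftCreation_nil {d : ℕ} (v : EuclideanSpace ℂ (Fin d)) (x : Space d) :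
    leftCreation v x [] = 0 := by
  have h : ∀ j : Fin d, relabel (fun w => j :: w) (List.cons_injective) x [] = 0 := fun j =>
    relabel_apply_of_notMem _ x _ (by simp)
  rw [leftCreation, sum_smul_apply]
  simp [h]

theorem leftCreation_cons {d : ℕ} (v : EuclideanSpace ℂ (Fin d)) (x : Space d) (j : Fin d)
    (w : List (Fin d)) : leftCreation v x (j :: w) = v j * x w := by
  have h : ∀ k : Fin d, relabel (fun w => k :: w) (List.cons_injective) x (j :: w) =
      if k = j then x w else 0 := by
    intro k
    split_ifs with hk
    · subst hk
      exact relabel_apply (u := fun w => k :: w) _ x w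
    · exact relabel_apply_of_notMem _ x _ (by simp [hk])
  rw [leftCreation, sum_smul_apply]
  simp [h]

theorem rightCreation_nil {d : ℕ} (v : EuclideanSpace ℂ (Fin d)) (x : Space d) :
    rightCreation v x [] = 0 := by
  have h : ∀ j : Fin d,
      relabel (fun w => w ++ [j]) (List.append_left_injective [j]) x [] = 0 := fun j =>
    relabel_apply_of_notMem _ x _ (by simp)
  rw [rightCreation, sum_smul_apply]
  simp [h]

theorem rightCreation_append {d : ℕ} (v : EuclideanSpace ℂ (Fin d)) (x : Space d) (j : Fin d)
    (w : List (Fin d)) : rightCreation v x (w ++ [j]) = v j * x w := by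
  have h : ∀ k : Fin d,
      relabel (fun w => w ++ [k]) (List.append_left_injective [k]) x (w ++ [j]) =
        if k = j then x w else 0 := by
    intro k
    split_ifs with hk
    · subst hk
      exact relabel_apply (u := fun w => w ++ [k]) _ x w
    · exact relabel_apply_of_notMem _ x _ (by simp [hk])
  rw [rightCreation, sum_smul_apply]
  simp [h]

/-- Polynomials in the non-commuting indeterminates `z₁, …, z_d`. -/
abbrev NCPolynomial (d : ℕ) : Type := MonoidAlgebra ℂ (FreeMonoid (Fin d))

/-- The coefficient of `z_{i₁} ⋯ z_{iₙ}` in `f`. -/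
def ncCoeff {d : ℕ} (f : NCPolynomial d) (w : List (Fin d)) : ℂ := f.coeff (FreeMonoid.ofList w)

/-- The operator `S^* (I + ∑ α_{(i₁, …, iₙ)} S_{iₙ} ⋯ S_{i₁})`, where the sum is over the words
`(i₁, …, iₙ)` and the `α`'s are the coefficients of `f` (a polynomial without constant term), and
where `S^*` is the adjoint of `S_i`. -/
noncomputable def canonicalOp {d : ℕ} (S : Fin d → (Space d →L[ℂ] Space d)) (f : NCPolynomial d)
    (i : Fin d) : Space d →L[ℂ] Space d :=
  ContinuousLinearMap.adjoint (S i) *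
    (1 + ∑ w ∈ f.coeff.support, f.coeff w • ((FreeMonoid.toList w).reverse.map S).prod)

/-- The canonical operators `C_{i;ℓ} = A_i` (on the left, with symbol `f`) and `C_{i;r} = B_i` (on
the right, with symbol `g`), built from an orthonormal basis `e` of `ℂ^d`. -/
noncomputable def canonical {d : ℕ} (e : OrthonormalBasis (Fin d) ℂ (EuclideanSpace ℂ (Fin d)))
    (f g : NCPolynomial d) (i : Fin d) (h : Side) : Space d →L[ℂ] Space d :=
  match h with
  | Side.left => canonicalOp (fun j => leftCreation (e j)) f i
  | Side.right => canonicalOp (fun j => rightCreation (e j)) g i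

end Fock

/-- The list, in increasing order, of the positions where the letter `h` occurs in `χ`. -/
def occurrences {n : ℕ} (χ : Fin n → Side) (h : Side) : List (Fin n) :=
  (List.finRange n).filter (fun m => χ m = h)

/-! The functional `x ↦ ⟨C₁⋯C_t x, ξ⟩`, with `ξ` the vacuum, is on basis tensors a finite weighted
sum of point evaluations at words. One more canonical operator on the side `h` acts on these words
by duality: `Sᵢ^*` puts the letter `i` at the end `h`, and `I + ∑ α S⋯S` then takes an arbitrary,
possibly empty, subword off that end, at the price of a coefficient (`map_canonical_wordVector`).
Hence a joint moment is a sum over the runs of a queue in which each move inserts one ball and takes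
out a group of balls, the queue being empty at the end (`inner_vacuum_prod_canonical`).

The groups taken out partition the set of times, and each group leaves at the largest time in it.
The queue keeps left times in decreasing order, followed by right times in increasing order, and a
partition arises exactly when it is non-crossing for this order (`IsBlockTag.queue_eq`,
`exists_isBlockTag`). A deque-scenario does the opposite: it inserts groups and takes out single
balls. Run backwards in time, it produces the partitions that are non-crossing when left times
increase and are followed by right times in decreasing order (`IsOutputTag.exists_scenario`,
`exists_isOutputTag`). Placed on a circle, the two orders differ by a reflection and a rotation,
which preserve non-crossing (`isNonCrossing_outputKey_iff`). So both sums run over the same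
partitions (`mem_partitions_iff`).

The weight of a block `V` is a coefficient of `f` or `g`, chosen by the side of `max V`, and it
depends only on the restrictions of `χ` and of the indices to `V`. Thus the coefficients satisfy the
moment-cumulant formula on canonical operators (`vacuumState_prod_canonical`). That formula
determines the one-block term recursively, which identifies it with the cumulant
(`cumulant_canonical`). -/

namespace Fock

/-! ### Creation operators and the tensor basis of the Fock space. -/

section FockVectors

variable {d : ℕ}

theorem inner_relabel_of_ne {u v : List (Fin d) → List (Fin d)} (hu : Function.Injective u)
    (hv : Function.Injective v) (huv : ∀ w w', u w ≠ v w') (x y : Space d) :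
    inner ℂ (relabel u hu x) (relabel v hv y) = 0 := by
  rw [lp.inner_eq_tsum]
  refine (tsum_congr fun w => ?_).trans tsum_zero
  by_cases hw : ∃ w', u w' = w
  · obtain ⟨w', rfl⟩ := hw
    rw [relabel_apply_of_notMem hv y _ (fun ⟨w'', h⟩ => huv w' w'' h.symm), inner_zero_right]
  · rw [relabel_apply_of_notMem hu x _ hw, inner_zero_left]

theorem inner_sum_relabel (F : Fin d → (Space d →ₗᵢ[ℂ] Space d))
    (hF : ∀ j k, j ≠ k → ∀ x y, inner ℂ (F j x) (F k y) = 0)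
    (u v : EuclideanSpace ℂ (Fin d)) (x y : Space d) :
    inner ℂ ((∑ j, u j • (F j).toContinuousLinearMap : Space d →L[ℂ] Space d) x)
      ((∑ j, v j • (F j).toContinuousLinearMap : Space d →L[ℂ] Space d) y) =
      inner ℂ u v * inner ℂ x y := by
  have h1 (v : EuclideanSpace ℂ (Fin d)) (x : Space d) :
      (∑ j, v j • (F j).toContinuousLinearMap : Space d →L[ℂ] Space d) x =
      ∑ j, v j • F j x := by simp
  rw [h1, h1, sum_inner, PiLp.inner_apply, Finset.sum_mul]
  refine Finset.sum_congr rfl fun j _ => ?_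
  rw [inner_sum, Finset.sum_eq_single j]
  · rw [inner_smul_left, inner_smul_right, LinearIsometry.inner_map_map]
    simp only [RCLike.inner_apply]
    ring
  · intro k _ hk
    rw [inner_smul_left, inner_smul_right, hF j k hk.symm]
    simp
  · simp

/-- The creation operator on the side `h`. -/
noncomputable def creation (h : Side) (v : EuclideanSpace ℂ (Fin d)) : Space d →L[ℂ] Space d :=
  match h with
  | Side.left => leftCreation v
  | Side.right => rightCreation v

theorem inner_creation_creation (h : Side) (u v : EuclideanSpace ℂ (Fin d)) (x y : Space d) :
    inner ℂ (creation h u x) (creation h v y) = inner ℂ u v * inner ℂ x y := by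
  cases h
  · refine inner_sum_relabel _ (fun j k hjk x y => inner_relabel_of_ne _ _ ?_ x y) u v x y
    intro w w' hw
    exact hjk (List.cons.inj hw).1
  · refine inner_sum_relabel _ (fun j k hjk x y => inner_relabel_of_ne _ _ ?_ x y) u v x y
    intro w w' hw
    simp only [List.append_singleton_inj] at hw
    exact hjk hw.2

theorem creation_apply_nil (h : Side) (v : EuclideanSpace ℂ (Fin d)) (x : Space d) :
    creation h v x [] = 0 := by
  cases h
  · exact leftCreation_nil v x
  · exact rightCreation_nil v x

theorem adjoint_creation_creation (h : Side) (u v : EuclideanSpace ℂ (Fin d)) (x : Space d) :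
    ContinuousLinearMap.adjoint (creation h u) (creation h v x) = (inner ℂ u v : ℂ) • x := by
  refine ext_inner_left ℂ fun z => ?_
  rw [ContinuousLinearMap.adjoint_inner_right, inner_creation_creation, inner_smul_right]

theorem adjoint_creation_vacuum (h : Side) (u : EuclideanSpace ℂ (Fin d)) :
    ContinuousLinearMap.adjoint (creation h u) (vacuum d) = 0 := by
  refine ext_inner_left ℂ fun z => ?_
  rw [ContinuousLinearMap.adjoint_inner_right, vacuum, lp.inner_single_right,
    creation_apply_nil]
  simp

/-- The two operators act at opposite ends of a word. A word of length one has to be treated apart,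
since its only letter is at both ends; both sides vanish there. -/
theorem leftCreation_rightCreation (u v : EuclideanSpace ℂ (Fin d)) (x : Space d) :
    leftCreation u (rightCreation v x) = rightCreation v (leftCreation u x) := by
  ext w
  rcases w with _ | ⟨j, w⟩
  · rw [leftCreation_nil, rightCreation_nil]
  · rw [leftCreation_cons]
    rcases List.eq_nil_or_concat' w with rfl | ⟨w, k, rfl⟩
    · have := rightCreation_append v (leftCreation u x) j []
      rw [List.nil_append] at this
      rw [this, leftCreation_nil, rightCreation_nil, mul_zero, mul_zero]
    · rw [rightCreation_append, ← List.cons_append, rightCreation_append, leftCreation_cons]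
      ring

theorem vacuum_apply_of_ne {w : List (Fin d)} (hw : w ≠ []) : (vacuum d : Space d) w = 0 := by
  simp [vacuum, hw]

theorem rightCreation_vacuum (v : EuclideanSpace ℂ (Fin d)) :
    rightCreation v (vacuum d) = leftCreation v (vacuum d) := by
  ext w
  rcases w with _ | ⟨j, w⟩
  · rw [leftCreation_nil, rightCreation_nil]
  · rw [leftCreation_cons]
    rcases List.eq_nil_or_concat' w with rfl | ⟨w, k, rfl⟩
    · exact rightCreation_append v _ j []
    · rw [← List.cons_append, rightCreation_append, vacuum_apply_of_ne (by simp),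
        vacuum_apply_of_ne (by simp), mul_zero, mul_zero]

variable (e : OrthonormalBasis (Fin d) ℂ (EuclideanSpace ℂ (Fin d)))

/-- The tensor `e_{j₁} ⊗ ⋯ ⊗ e_{jₙ}` of the word `(j₁, …, jₙ)`. -/
noncomputable def wordVector : List (Fin d) → Space d
  | [] => vacuum d
  | j :: w => leftCreation (e j) (wordVector w)

theorem rightCreation_wordVector (j : Fin d) (w : List (Fin d)) :
    rightCreation (e j) (wordVector e w) = wordVector e (w ++ [j]) := by
  induction w with
  | nil => exact rightCreation_vacuum _
  | cons k w ih =>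
    rw [wordVector, ← leftCreation_rightCreation, ih]
    rfl

end FockVectors

end Fock

/-! ### Reading lists from either end, so that both sides get one treatment. -/

/-- A list, read from the side `h`. -/
def Side.read {α : Type*} (h : Side) (l : List α) : List α :=
  match h with
  | Side.left => l
  | Side.right => l.reverse

namespace Side

@[simp]
theorem read_read {α : Type*} (h : Side) (l : List α) : h.read (h.read l) = l := by
  cases h <;> simp [read]

@[simp]
theorem length_read {α : Type*} (h : Side) (l : List α) : (h.read l).length = l.length := by
  cases h <;> simp [read]

@[simp]
theorem read_nil {α : Type*} (h : Side) : h.read ([] : List α) = [] := by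
  cases h <;> rfl

theorem map_read {α β : Type*} (h : Side) (φ : α → β) (l : List α) :
    (h.read l).map φ = h.read (l.map φ) := by
  cases h <;> simp [read]

theorem filter_read {α : Type*} (h : Side) (P : α → Bool) (l : List α) :
    (h.read l).filter P = h.read (l.filter P) := by
  cases h <;> simp [read]

@[simp]
theorem mem_read {α : Type*} (h : Side) (l : List α) (x : α) : x ∈ h.read l ↔ x ∈ l := by
  cases h <;> simp [read]

theorem read_eq_iff {α : Type*} (h : Side) (l l' : List α) : h.read l = l' ↔ l = h.read l' :=
  ⟨fun H => by rw [← H, read_read], fun H => by rw [H, read_read]⟩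

end Side

/-! ### Canonical operators on basis tensors, and the dual action on functionals. -/

namespace Fock

section CanonicalOperators

variable {d : ℕ} (e : OrthonormalBasis (Fin d) ℂ (EuclideanSpace ℂ (Fin d)))

theorem creation_wordVector (h : Side) (j : Fin d) (w : List (Fin d)) :
    creation h (e j) (wordVector e (h.read w)) = wordVector e (h.read (j :: w)) := by
  cases h
  · rfl
  · simp only [creation, Side.read, List.reverse_cons]
    exact rightCreation_wordVector e j _

theorem prod_creation_wordVector (h : Side) (l w : List (Fin d)) :
    (l.map fun j => creation h (e j)).prod (wordVector e (h.read w)) =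
      wordVector e (h.read (l ++ w)) := by
  induction l with
  | nil => simp
  | cons j l ih =>
    rw [List.map_cons, List.prod_cons, mul_apply_eq_comp, ih, creation_wordVector]
    rfl

/-- The coefficient of the word `w` in `1 + f`, where `f` has no constant term. -/
noncomputable def symbolCoeff (f : NCPolynomial d) (w : List (Fin d)) : ℂ :=
  if w = [] then 1 else ncCoeff f w

/-- The summand `I` is absorbed as the term of the empty word, with coefficient `1`. As `f` has no
constant term, this word is not counted twice. -/
theorem exists_canonicalOp_wordVector (h : Side) (f : NCPolynomial d) (hf : ncCoeff f [] = 0)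
    (i : Fin d) : ∃ T : Finset (List (Fin d)), (∀ w ∉ T, symbolCoeff f w = 0) ∧
      ∀ v, canonicalOp (fun j => creation h (e j)) f i (wordVector e (h.read v)) =
        ∑ w ∈ T, symbolCoeff f w •
          ContinuousLinearMap.adjoint (creation h (e i))
            (wordVector e (h.read (w.reverse ++ v))) := by
  classical
  have h0 : ([] : List (Fin d)) ∉ f.coeff.support.image FreeMonoid.toList := by
    intro hmem
    obtain ⟨w, hw, hw'⟩ := Finset.mem_image.1 hmem
    refine Finsupp.mem_support_iff.1 hw ?_
    rw [← hf, ncCoeff, ← hw']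
    rfl
  refine ⟨insert [] (f.coeff.support.image FreeMonoid.toList), ?_, ?_⟩
  · intro w hw
    simp only [Finset.mem_insert, not_or] at hw
    rw [symbolCoeff, if_neg hw.1]
    by_contra hne
    exact hw.2 (Finset.mem_image.2 ⟨FreeMonoid.ofList w, Finsupp.mem_support_iff.2 hne, rfl⟩)
  · intro v
    rw [Finset.sum_insert h0, Finset.sum_image (FreeMonoid.toList.injective.injOn),
      canonicalOp, mul_apply_eq_comp, _root_.add_apply, map_add,
      _root_.sum_apply, map_sum]
    congr 1
    · simp [symbolCoeff]
    · refine Finset.sum_congr rfl fun w hw => ?_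
      rw [_root_.smul_apply, map_smul, prod_creation_wordVector, symbolCoeff,
        if_neg]
      · rfl
      · rintro h
        exact h0 (Finset.mem_image.2 ⟨w, hw, h⟩)

/-- The coefficient function of the canonical operators on the side `h`. -/
noncomputable def sideCoeff (f g : NCPolynomial d) (h : Side) (w : List (Fin d)) : ℂ :=
  match h with
  | Side.left => symbolCoeff f w
  | Side.right => symbolCoeff g w

theorem exists_canonical_wordVector (f g : NCPolynomial d) (hf : ncCoeff f [] = 0)
    (hg : ncCoeff g [] = 0) (i : Fin d) (h : Side) :
    ∃ T : Finset (List (Fin d)), (∀ w ∉ T, sideCoeff f g h w = 0) ∧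
      ∀ v, canonical e f g i h (wordVector e (h.read v)) =
        ∑ w ∈ T, sideCoeff f g h w •
          ContinuousLinearMap.adjoint (creation h (e i))
            (wordVector e (h.read (w.reverse ++ v))) := by
  cases h
  · exact exists_canonicalOp_wordVector e Side.left f hf i
  · exact exists_canonicalOp_wordVector e Side.right g hg i

theorem adjoint_creation_wordVector (h : Side) (i j : Fin d) (v : List (Fin d)) :
    ContinuousLinearMap.adjoint (creation h (e i)) (wordVector e (h.read (j :: v))) =
      if i = j then wordVector e (h.read v) else 0 := by
  rw [← creation_wordVector, adjoint_creation_creation, e.inner_eq_ite]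
  split_ifs <;> simp

/-- A functional is recorded by finitely many words `b a` with weights `W a`. Precomposition with an
annihilation operator puts the letter `i` at the end `h` of each of these words and keeps the
weights. -/
theorem map_adjoint_creation_wordVector {ι : Type*} (T : Finset ι) (W : ι → ℂ)
    (b : ι → List (Fin d)) (Λ : Space d →ₗ[ℂ] ℂ)
    (hΛ : ∀ v, Λ (wordVector e v) = ∑ a ∈ T, if b a = v then W a else 0)
    (h : Side) (i : Fin d) (u : List (Fin d)) :
    Λ (ContinuousLinearMap.adjoint (creation h (e i)) (wordVector e (h.read u))) =
      ∑ a ∈ T, if i :: h.read (b a) = u then W a else 0 := by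
  rcases u with _ | ⟨j, u⟩
  · have : wordVector e (h.read []) = vacuum d := by simp [wordVector]
    rw [this, adjoint_creation_vacuum]
    simp
  · rw [adjoint_creation_wordVector]
    by_cases hij : i = j
    · subst hij
      rw [if_pos rfl, hΛ]
      refine Finset.sum_congr rfl fun a _ => ?_
      simp only [List.cons.injEq, true_and, Side.read_eq_iff]
    · rw [if_neg hij, map_zero]
      simp [hij]

/-- Each side has at most one nonzero term, and none unless `v` is a suffix of `u`. A sum over words
thereby becomes a sum over the cut positions of `u`, that is, over the number of balls taken out. -/
theorem sum_reverse_append_eq {α : Type*} [DecidableEq α] (c : List α → ℂ) (T : Finset (List α))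
    (hT : ∀ w ∉ T, c w = 0) (u v : List α) :
    (∑ w ∈ T, if u = w.reverse ++ v then c w else 0) =
      ∑ k ∈ Finset.range (u.length + 1),
        if u.drop k = v then c (u.take k).reverse else 0 := by
  by_cases hv : ∃ w, u = w ++ v
  · obtain ⟨w, rfl⟩ := hv
    trans c w.reverse
    · rw [Finset.sum_eq_single w.reverse]
      · simp
      · intro w' _ hw'
        rw [if_neg]
        intro h
        apply hw'
        rw [List.append_cancel_right h, List.reverse_reverse]
      · intro h
        simp [hT _ h]
    · rw [Finset.sum_eq_single w.length]
      · simp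
      · intro k hk hkw
        rw [if_neg]
        intro h
        have := congrArg List.length h
        simp only [List.length_drop, List.length_append, Finset.mem_range] at this hk
        omega
      · intro h
        simp at h
  · rw [Finset.sum_eq_zero, Finset.sum_eq_zero]
    · intro k _
      rw [if_neg]
      rintro rfl
      exact hv ⟨u.take k, (List.take_append_drop k u).symm⟩
    · intro w _
      rw [if_neg]
      intro h
      exact hv ⟨_, h⟩

/-- The action of a canonical operator on a functional: a letter is put at the end `h` of a word,
and then a subword is taken out at the same end. -/
theorem map_canonical_wordVector (f g : NCPolynomial d) (hf : ncCoeff f [] = 0)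
    (hg : ncCoeff g [] = 0) {ι : Type*} (T : Finset ι) (W : ι → ℂ)
    (b : ι → List (Fin d)) (Λ : Space d →ₗ[ℂ] ℂ)
    (hΛ : ∀ v, Λ (wordVector e v) = ∑ a ∈ T, if b a = v then W a else 0)
    (h : Side) (i : Fin d) (v : List (Fin d)) :
    Λ (canonical e f g i h (wordVector e v)) =
      ∑ a ∈ T, ∑ k ∈ Finset.range ((b a).length + 2),
        if h.read ((i :: h.read (b a)).drop k) = v then
          W a * sideCoeff f g h ((i :: h.read (b a)).take k).reverse else 0 := by
  obtain ⟨S, hS, hC⟩ := exists_canonical_wordVector e f g hf hg i h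
  have hCv := hC (h.read v)
  rw [Side.read_read] at hCv
  rw [hCv, map_sum]
  simp only [map_smul, map_adjoint_creation_wordVector e T W b Λ hΛ, smul_eq_mul, Finset.mul_sum]
  rw [Finset.sum_comm]
  refine Finset.sum_congr rfl fun a _ => ?_
  have key := sum_reverse_append_eq (sideCoeff f g h) S hS (i :: h.read (b a)) (h.read v)
  simp only [List.length_cons, Side.length_read] at key
  simp only [Side.read_eq_iff]
  have e1 : ∀ (P : Prop) [Decidable P] (x : ℂ),
      (if P then W a * x else 0) = W a * if P then x else 0 := by
    intro P _ x
    split_ifs <;> simp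
  simp only [e1]
  rw [← Finset.mul_sum, ← key, Finset.mul_sum]
  refine Finset.sum_congr rfl fun w _ => ?_
  split_ifs <;> ring

end CanonicalOperators

end Fock

/-! ### Queues from which blocks are removed -/

namespace BlockQueue

/-- The content, read from left to right, of a queue after `t` moves. The move `t` inserts the ball
`t` at the end `χ t`, and then removes the `p t` balls that are closest to this end. -/
def queue (χ : ℕ → Side) (p : ℕ → ℕ) : ℕ → List ℕ
  | 0 => []
  | t + 1 => (χ t).read ((t :: (χ t).read (queue χ p t)).drop (p t))

/-- The balls that are removed by the move `t`, read from the end `χ t`. -/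
def removed (χ : ℕ → Side) (p : ℕ → ℕ) (t : ℕ) : List ℕ :=
  (t :: (χ t).read (queue χ p t)).take (p t)

theorem queue_congr {χ : ℕ → Side} {p q : ℕ → ℕ} {t : ℕ} (h : ∀ s < t, p s = q s) :
    queue χ p t = queue χ q t := by
  induction t with
  | zero => rfl
  | succ t ih =>
    rw [queue, queue, ih fun s hs => h s (hs.trans t.lt_succ_self), h t t.lt_succ_self]

theorem removed_congr {χ : ℕ → Side} {p q : ℕ → ℕ} {t : ℕ} (h : ∀ s ≤ t, p s = q s) :
    removed χ p t = removed χ q t := by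
  rw [removed, removed, queue_congr fun s hs => h s hs.le, h t le_rfl]

open scoped Classical in
/-- The sequences `p` for which no move before the time `t` removes more balls than there are, and
no later move removes any balls. -/
noncomputable def admissible (χ : ℕ → Side) : ℕ → Finset (ℕ → ℕ)
  | 0 => {0}
  | t + 1 => (admissible χ t).biUnion fun p =>
      (Finset.range ((queue χ p t).length + 2)).image (Function.update p t)

/-- The vanishing from `t` on makes finitely many functions on `ℕ` stand for the runs of length `t`.
-/
theorem mem_admissible {χ : ℕ → Side} {t : ℕ} {p : ℕ → ℕ} :
    p ∈ admissible χ t ↔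
      (∀ s < t, p s ≤ (queue χ p s).length + 1) ∧ ∀ s, t ≤ s → p s = 0 := by
  induction t generalizing p with
  | zero =>
    simp only [admissible, Finset.mem_singleton]
    constructor
    · rintro rfl
      simp
    · rintro ⟨-, h⟩
      funext s
      exact h s (Nat.zero_le s)
  | succ t ih =>
    simp only [admissible, Finset.mem_biUnion, Finset.mem_image, Finset.mem_range]
    constructor
    · rintro ⟨q, hq, k, hk, rfl⟩
      obtain ⟨h1, h2⟩ := ih.1 hq
      have hc : ∀ s ≤ t, queue χ (Function.update q t k) s = queue χ q s := fun s hs =>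
        queue_congr fun r hr => Function.update_of_ne (by omega) _ _
      refine ⟨fun s hs => ?_, fun s hs => ?_⟩
      · rw [hc s (by omega)]
        rcases eq_or_ne s t with rfl | hst
        · rw [Function.update_self]
          omega
        · rw [Function.update_of_ne hst]
          exact h1 s (by omega)
      · rw [Function.update_of_ne (by omega)]
        exact h2 s (by omega)
    · rintro ⟨h1, h2⟩
      have hc : ∀ s ≤ t, queue χ (Function.update p t 0) s = queue χ p s := fun s hs =>
        queue_congr fun r hr => Function.update_of_ne (by omega) _ _
      refine ⟨Function.update p t 0, ih.2 ⟨fun s hs => ?_, fun s hs => ?_⟩, p t, ?_, ?_⟩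
      · rw [hc s hs.le, Function.update_of_ne hs.ne]
        exact h1 s (by omega)
      · rcases eq_or_ne s t with rfl | hst
        · exact Function.update_self _ _ _
        · rw [Function.update_of_ne hst]
          exact h2 s (by omega)
      · rw [hc t le_rfl]
        have := h1 t (by omega)
        omega
      · simp

theorem sum_admissible_succ {M : Type*} [AddCommMonoid M] (χ : ℕ → Side) (t : ℕ)
    (F : (ℕ → ℕ) → M) :
    ∑ p ∈ admissible χ (t + 1), F p =
      ∑ p ∈ admissible χ t, ∑ k ∈ Finset.range ((queue χ p t).length + 2),
        F (Function.update p t k) := by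
  classical
  rw [admissible, Finset.sum_biUnion]
  · refine Finset.sum_congr rfl fun p _ => ?_
    rw [Finset.sum_image]
    exact fun _ _ _ _ h => Function.update_injective p t h
  · intro p hp q hq hpq
    rw [Function.onFun, Finset.disjoint_left]
    intro r hr hr'
    obtain ⟨k, -, rfl⟩ := Finset.mem_image.1 hr
    obtain ⟨l, -, h⟩ := Finset.mem_image.1 hr'
    apply hpq
    funext s
    rcases eq_or_ne s t with rfl | hst
    -- The value overwritten at the time `t` was `0` in both sequences, so the update loses no
    -- information.
    · rw [(mem_admissible.1 hp).2 s le_rfl, (mem_admissible.1 hq).2 s le_rfl]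
    · simpa [Function.update_of_ne hst] using (congrFun h s).symm

end BlockQueue

/-! ### Joint moments as sums over runs of the queue. -/

namespace Fock

variable {d : ℕ} (e : OrthonormalBasis (Fin d) ℂ (EuclideanSpace ℂ (Fin d)))

theorem inner_vacuum_wordVector (v : List (Fin d)) :
    inner ℂ (vacuum d) (wordVector e v) = if ([] : List (Fin d)) = v then 1 else 0 := by
  rcases v with _ | ⟨j, v⟩
  · simp [wordVector, vacuum]
  · rw [vacuum, lp.inner_single_left, wordVector, leftCreation_nil]
    simp

open BlockQueue in
-- Keeping `v` arbitrary is what lets the induction run: the content of the queue after `t` moves is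
-- the word seen by the functional. The moment itself is the case `v = []`.
theorem inner_vacuum_prod_canonical (f g : NCPolynomial d) (hf : ncCoeff f [] = 0)
    (hg : ncCoeff g [] = 0) (χ : ℕ → Side) (i : ℕ → Fin d) (t : ℕ) (v : List (Fin d)) :
    inner ℂ (vacuum d)
        (((List.range t).map fun s => canonical e f g (i s) (χ s)).prod (wordVector e v)) =
      ∑ p ∈ admissible χ t, if (queue χ p t).map i = v then
        ∏ s ∈ Finset.range t, sideCoeff f g (χ s) ((removed χ p s).reverse.map i) else 0 := by
  induction t generalizing v with
  | zero =>
    rw [admissible, Finset.sum_singleton]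
    simp [inner_vacuum_wordVector, queue]
  | succ t ih =>
    rw [List.range_succ, List.map_append, List.prod_append, List.map_singleton,
      List.prod_singleton, mul_apply_eq_comp]
    have key := map_canonical_wordVector e f g hf hg _ _ (fun p => (queue χ p t).map i)
      (((innerSL ℂ (vacuum d)).comp
        ((List.range t).map fun s => canonical e f g (i s) (χ s)).prod).toLinearMap)
      ih (χ t) (i t) v
    refine key.trans ?_
    rw [sum_admissible_succ]
    refine Finset.sum_congr rfl fun p _ => ?_
    rw [List.length_map]
    refine Finset.sum_congr rfl fun k _ => ?_
    have hc : ∀ s ≤ t, queue χ (Function.update p t k) s = queue χ p s := fun s hs =>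
      queue_congr fun r hr => Function.update_of_ne (by omega) _ _
    rw [queue, hc t le_rfl, Function.update_self, Finset.prod_range_succ, removed, hc t le_rfl,
      Function.update_self, Side.map_read, List.map_drop, List.map_reverse, List.map_take,
      List.map_cons, Side.map_read]
    congr 2
    refine Finset.prod_congr rfl fun s hs => ?_
    rw [Finset.mem_range] at hs
    rw [removed_congr (p := Function.update p t k) (q := p) fun r hr =>
      Function.update_of_ne (hr.trans_lt hs).ne _ _]

end Fock

/-! ### Runs that empty the queue, and non-crossing partitions. -/

namespace BlockQueue

/-- The position of the time `x` in the order in which the left times decrease, followed by the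
right times in increasing order. -/
def key (χ : ℕ → Side) (x : ℕ) : ℤ :=
  match χ x with
  | Side.left => -(x : ℤ) - 1
  | Side.right => x

/-- Left times have negative keys and right times nonnegative ones, and on each side later times lie
farther out. So anything between two times is no later than one of them. -/
theorem le_max_of_key {χ : ℕ → Side} {x y z : ℕ} (h1 : key χ x < key χ y)
    (h2 : key χ y < key χ z) : y ≤ max x z := by
  unfold key at h1 h2
  cases hx : χ x <;> cases hy : χ y <;> cases hz : χ z <;> simp only [hx, hy, hz] at h1 h2 <;> omega

/-- The times before `t`, in the order given by `key`. -/
def timeList (χ : ℕ → Side) : ℕ → List ℕ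
  | 0 => []
  | t + 1 => (χ t).read (t :: (χ t).read (timeList χ t))

theorem mem_timeList {χ : ℕ → Side} {t x : ℕ} : x ∈ timeList χ t ↔ x < t := by
  induction t with
  | zero => simp [timeList]
  | succ t ih =>
    simp only [timeList, Side.mem_read, List.mem_cons, ih]
    omega

theorem timeList_eq (χ : ℕ → Side) (t : ℕ) :
    timeList χ t = ((List.range t).filter fun x => χ x = Side.left).reverse ++
      (List.range t).filter fun x => χ x = Side.right := by
  induction t with
  | zero => rfl
  | succ t ih =>
    rw [timeList, ih, List.range_succ, List.filter_append, List.filter_append]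
    rcases h : χ t <;> simp [Side.read, h]

/-- The relation that `x` is met before `y` when times are read from the side `h` in the order given
by `key`. -/
def Before (χ : ℕ → Side) (h : Side) (x y : ℕ) : Prop :=
  match h with
  | Side.left => key χ x < key χ y
  | Side.right => key χ y < key χ x

theorem pairwise_read_timeList (χ : ℕ → Side) (h : Side) (t : ℕ) :
    (h.read (timeList χ t)).Pairwise (Before χ h) := by
  have main : (timeList χ t).Pairwise fun x y => key χ x < key χ y := by
    induction t with
    | zero => exact List.Pairwise.nil
    | succ t ih =>
      rw [timeList]
      rcases ht : χ t
      · refine List.pairwise_cons.2 ⟨fun x hx => ?_, ih⟩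
        have := mem_timeList.1 hx
        unfold key
        rw [ht]
        rcases χ x <;> simp only <;> omega
      · simp only [Side.read, List.reverse_cons, List.reverse_reverse]
        refine List.pairwise_append.2 ⟨ih, List.pairwise_singleton _ _, fun x hx y hy => ?_⟩
        rw [List.mem_singleton] at hy
        subst hy
        have := mem_timeList.1 hx
        unfold key
        rw [ht]
        rcases χ x <;> simp only <;> omega
  cases h
  · exact main
  · exact List.pairwise_reverse.2 main

/-- The function that sends each time before `n` to the largest time in its block, for a partition
which is non-crossing with respect to the order given by `key`. -/
structure IsBlockTag (χ : ℕ → Side) (n : ℕ) (g : ℕ → ℕ) : Prop where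
  le_tag : ∀ x < n, x ≤ g x
  tag_lt : ∀ x < n, g x < n
  tag_tag : ∀ x < n, g (g x) = g x
  convex : ∀ x < n, ∀ y < n, ∀ z < n, key χ x < key χ y → key χ y < key χ z → g x = g z →
    g y ≤ g x

/-- By hypothesis no element with tag above `t` precedes one with tag `t`. So the block that closes
at the time `t` is a prefix of what is present, and can be removed from the end. -/
theorem filter_le_eq_append (g : ℕ → ℕ) (t : ℕ) (l : List ℕ)
    (h : l.Pairwise fun x y => g y = t → ¬ t < g x) :
    l.filter (fun x => t ≤ g x) =
      l.filter (fun x => g x = t) ++ l.filter (fun x => t + 1 ≤ g x) := by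
  induction l with
  | nil => rfl
  | cons x l ih =>
    obtain ⟨h1, h2⟩ := List.pairwise_cons.1 h
    rcases lt_trichotomy (g x) t with hx | hx | hx
    · rw [List.filter_cons_of_neg (by simpa using hx), List.filter_cons_of_neg (by simpa using hx.ne),
        List.filter_cons_of_neg (by simp; omega), ih h2]
    · rw [List.filter_cons_of_pos (by simpa using hx.ge), List.filter_cons_of_pos (by simpa using hx),
        List.filter_cons_of_neg (by simp; omega), ih h2, List.cons_append]
    · rw [List.filter_cons_of_pos (by simpa using hx.le), List.filter_cons_of_neg (by simpa using hx.ne'),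
        List.filter_cons_of_pos (by simpa using hx), ih h2]
      have : l.filter (fun x => g x = t) = [] := by
        rw [List.filter_eq_nil_iff]
        intro y hy
        simpa using fun hyt => h1 y hy hyt hx
      rw [this]
      rfl

/-- If each move takes out as many balls as the block closing at that time contains, then the queue
always consists of the past times whose blocks are still open, and exactly the closing block leaves.
-/
theorem IsBlockTag.queue_eq {χ : ℕ → Side} {n : ℕ} {g p : ℕ → ℕ} (hg : IsBlockTag χ n g)
    (hp : ∀ s < n, p s = ((timeList χ (s + 1)).filter fun x => g x = s).length) :
    (∀ t ≤ n, queue χ p t = (timeList χ t).filter fun x => t ≤ g x) ∧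
      ∀ t < n, removed χ p t = (χ t).read ((timeList χ (t + 1)).filter fun x => g x = t) := by
  have step : ∀ t < n, queue χ p t = ((timeList χ t).filter fun x => t ≤ g x) →
      t :: (χ t).read (queue χ p t) =
        (χ t).read ((timeList χ (t + 1)).filter fun x => g x = t) ++
        (χ t).read ((timeList χ (t + 1)).filter fun x => t + 1 ≤ g x) := by
    intro t ht hq
    have e1 : t :: (χ t).read (queue χ p t) =
        ((χ t).read (timeList χ (t + 1))).filter fun x => t ≤ g x := by
      rw [timeList, Side.read_read, hq, List.filter_cons_of_pos (by simpa using hg.le_tag t ht),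
        Side.filter_read]
    rw [e1, ← Side.filter_read, ← Side.filter_read]
    apply filter_le_eq_append
    have hU := pairwise_read_timeList χ (χ t) (t + 1)
    have hmem : ∀ x ∈ (χ t).read (timeList χ (t + 1)), x < t + 1 := by
      simp [mem_timeList]
    have hhead : ∀ x ∈ (χ t).read (timeList χ (t + 1)), x = t ∨ Before χ (χ t) t x := by
      rw [timeList, Side.read_read] at hU ⊢
      intro x hx
      rcases List.mem_cons.1 hx with rfl | hx
      · exact Or.inl rfl
      · exact Or.inr ((List.pairwise_cons.1 hU).1 x hx)
    -- The newest time `t` is read first and has tag `t` as soon as some `y` does. An `x` read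
    -- before `y` is then `t` itself or lies between `t` and `y`, so convexity bounds its tag.
    refine hU.imp_of_mem fun {x y} hx hy hxy hgy hgx => ?_
    have hxn := hmem x hx
    have hyn := hmem y hy
    have hgt : g t = t := by
      have := hg.tag_tag y (by omega)
      rwa [hgy] at this
    rcases hhead x hx with rfl | hx'
    · omega
    · have : g x ≤ t := by
        revert hx' hxy
        cases χ t <;> intro hxy hx'
        · have := hg.convex t (by omega) x (by omega) y (by omega) hx' hxy (by omega)
          omega
        · have := hg.convex y (by omega) x (by omega) t (by omega) hxy hx' (by omega)
          omega
      omega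
  have hq : ∀ t ≤ n, queue χ p t = (timeList χ t).filter fun x => t ≤ g x := by
    intro t
    induction t with
    | zero => intro _; rfl
    | succ t ih =>
      intro ht
      rw [queue, step t ht (ih (by omega)), List.drop_left' (by rw [Side.length_read, hp t ht]),
        Side.read_read]
  refine ⟨hq, fun t ht => ?_⟩
  rw [removed, step t ht (hq t ht.le), List.take_left' (by rw [Side.length_read, hp t ht])]

theorem mem_removed_or_mem_queue_succ {χ : ℕ → Side} {p : ℕ → ℕ} {t x : ℕ} :
    (x ∈ removed χ p t ∨ x ∈ queue χ p (t + 1)) ↔ (x = t ∨ x ∈ queue χ p t) := by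
  rw [removed, queue, Side.mem_read, ← List.mem_append, List.take_append_drop, List.mem_cons,
    Side.mem_read]

theorem queue_sublist_timeList (χ : ℕ → Side) (p : ℕ → ℕ) (t : ℕ) :
    (queue χ p t).Sublist (timeList χ t) := by
  induction t with
  | zero => exact List.Sublist.refl _
  | succ t ih =>
    rw [queue, timeList]
    have : ∀ {h : Side} {l l' : List ℕ}, l.Sublist l' → (h.read l).Sublist (h.read l') := by
      intro h l l' H
      cases h
      · exact H
      · exact H.reverse
    exact this ((List.drop_sublist _ _).trans ((this ih).cons_cons t))

theorem nodup_timeList (χ : ℕ → Side) (t : ℕ) : (timeList χ t).Nodup :=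
  (pairwise_read_timeList χ Side.left t).imp fun {x y} h => by
    rintro rfl
    exact lt_irrefl _ h

/-- The queue has no repetitions and only the ball `t` enters at the time `t`, so a ball taken out
never returns. -/
theorem notMem_queue_of_mem_removed {χ : ℕ → Side} {p : ℕ → ℕ} {s t x : ℕ}
    (hx : x ∈ removed χ p s) (hst : s < t) : x ∉ queue χ p t := by
  induction t, hst using Nat.le_induction with
  | base =>
    have hnd : (s :: (χ s).read (queue χ p s)).Nodup := by
      have h1 := (queue_sublist_timeList χ p s).nodup (nodup_timeList χ s)
      refine List.nodup_cons.2 ⟨fun h => ?_, ?_⟩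
      · rw [Side.mem_read] at h
        exact lt_irrefl _ (mem_timeList.1 ((queue_sublist_timeList χ p s).subset h))
      · cases χ s
        · exact h1
        · exact List.nodup_reverse.2 h1
    rw [queue, Side.mem_read]
    rw [← List.take_append_drop (p s) (s :: _)] at hnd
    exact fun h => List.disjoint_of_nodup_append hnd hx h
  | succ t ht ih =>
    intro h
    have hxs : x ≤ s := by
      rcases mem_removed_or_mem_queue_succ.1 (Or.inl hx) with h | h
      · exact h.le
      · exact (mem_timeList.1 ((queue_sublist_timeList χ p s).subset h)).le
    rcases mem_removed_or_mem_queue_succ.1 (Or.inr h) with h | h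
    · omega
    · exact ih h

theorem exists_mem_removed {χ : ℕ → Side} {p : ℕ → ℕ} {t x : ℕ} (hx : x < t)
    (hq : x ∉ queue χ p t) : ∃ s < t, x ∈ removed χ p s := by
  induction t with
  | zero => omega
  | succ t ih =>
    by_cases h : x = t ∨ x ∈ queue χ p t
    · exact ⟨t, t.lt_succ_self, (mem_removed_or_mem_queue_succ.2 h).resolve_right hq⟩
    · rw [not_or] at h
      obtain ⟨s, hs, h'⟩ := ih (by omega) h.2
      exact ⟨s, by omega, h'⟩

/-- A sequence of moves that empties the queue produces the tag function of a partition. -/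
theorem exists_isBlockTag {χ : ℕ → Side} {n : ℕ} {p : ℕ → ℕ}
    (hp : ∀ s < n, p s ≤ (queue χ p s).length + 1) (hn : queue χ p n = []) :
    ∃ g, IsBlockTag χ n g ∧
      ∀ s < n, p s = ((timeList χ (s + 1)).filter fun x => g x = s).length := by
  have hex : ∀ x, ∃ s, x < n → s < n ∧ x ∈ removed χ p s := by
    intro x
    by_cases hx : x < n
    · obtain ⟨s, hs⟩ := exists_mem_removed (χ := χ) (p := p) (t := n) hx (by simp [hn])
      exact ⟨s, fun _ => hs⟩
    · exact ⟨0, fun h => absurd h hx⟩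
  -- The tag of a ball is the move that takes it out.
  choose g hg using hex
  have huniq : ∀ x s, x < n → x ∈ removed χ p s → g x = s := by
    intro x s hx hs
    obtain ⟨-, h⟩ := hg x hx
    have aux : ∀ s s', x ∈ removed χ p s → x ∈ removed χ p s' → ¬ s < s' := by
      intro s s' hs hs' hlt
      have hxs : x ≤ s := by
        rcases mem_removed_or_mem_queue_succ.1 (Or.inl hs) with h | h
        · exact h.le
        · exact (mem_timeList.1 ((queue_sublist_timeList χ p s).subset h)).le
      rcases mem_removed_or_mem_queue_succ.1 (Or.inl hs') with h | h
      · omega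
      · exact notMem_queue_of_mem_removed hs hlt h
    exact le_antisymm (not_lt.1 (aux _ _ hs h)) (not_lt.1 (aux _ _ h hs))
  have hle : ∀ x < n, x ≤ g x := by
    intro x hx
    rcases mem_removed_or_mem_queue_succ.1 (Or.inl (hg x hx).2) with h | h
    · exact h.le
    · exact (mem_timeList.1 ((queue_sublist_timeList χ p _).subset h)).le
  have htake : ∀ t < n, ∀ x ∈ removed χ p t, x < n ∧ g x = t := by
    intro t ht x hx
    have hxn : x < n := by
      rcases mem_removed_or_mem_queue_succ.1 (Or.inl hx) with h | h
      · omega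
      · exact (mem_timeList.1 ((queue_sublist_timeList χ p _).subset h)).trans ht
    exact ⟨hxn, huniq x t hxn hx⟩
  have hdrop : ∀ t < n, ∀ x ∈ (t :: (χ t).read (queue χ p t)).drop (p t), t + 1 ≤ g x := by
    intro t ht x hx
    have hx' : x ∈ queue χ p (t + 1) := by
      rwa [queue, Side.mem_read]
    have hxn : x < n :=
      (mem_timeList.1 ((queue_sublist_timeList χ p _).subset hx')).trans_le ht
    by_contra hlt
    exact notMem_queue_of_mem_removed (hg x hxn).2 (by omega) hx'
  have hstep : ∀ t < n, queue χ p t = ((timeList χ t).filter fun x => t ≤ g x) →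
      t :: (χ t).read (queue χ p t) =
        ((χ t).read (timeList χ (t + 1))).filter fun x => t ≤ g x := by
    intro t ht hq
    rw [timeList, Side.read_read, List.filter_cons_of_pos (by simpa using hle t ht), hq,
      Side.filter_read]
  have hq : ∀ t ≤ n, queue χ p t = (timeList χ t).filter fun x => t ≤ g x := by
    intro t
    induction t with
    | zero => intro _; rfl
    | succ t ih =>
      intro ht
      have h1 := hstep t ht (ih (by omega))
      have h2 := congrArg (List.filter fun x => t + 1 ≤ g x) h1
      rw [← List.take_append_drop (p t) (t :: _), List.filter_append,
        List.filter_eq_nil_iff.2 (by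
          intro x hx
          have := htake t ht x hx
          simp
          omega),
        List.filter_eq_self.2 (by
          intro x hx
          simpa using hdrop t ht x hx), List.nil_append, List.filter_filter] at h2
      rw [queue, h2, ← Side.filter_read, Side.read_read]
      apply List.filter_congr
      intro x _
      simp
      omega
  refine ⟨g, ⟨hle, fun x hx => (hg x hx).1, fun x hx => ?_, ?_⟩, ?_⟩
  · obtain ⟨h1, h2⟩ := hg x hx
    apply huniq _ _ h1
    rw [removed] at h2 ⊢
    -- A move that removes anything removes the ball it has just inserted, so `g x` belongs to its
    -- own block.
    rcases h : p (g x) with _ | k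
    · rw [h] at h2
      simp at h2
    · simp
  · intro x hx y hy z hz hxy hyz hxz
    by_contra hlt
    have ht := (hg x hx).1
    have hst := hstep _ ht (hq _ ht.le)
    have hpw := (pairwise_read_timeList χ (χ (g x)) (g x + 1)).filter fun y => g x ≤ g y
    have hymem : y ∈ (χ (g x)).read (timeList χ (g x + 1)) := by
      rw [Side.mem_read, mem_timeList]
      have := le_max_of_key hxy hyz
      have := hle x hx
      have := hle z hz
      omega
    have hymem' : y ∈ g x :: (χ (g x)).read (queue χ p (g x)) := by
      rw [hst, List.mem_filter]
      refine ⟨hymem, ?_⟩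
      simp
      omega
    rw [← hst, ← List.take_append_drop (p (g x)) (g x :: _)] at hpw
    rw [← List.take_append_drop (p (g x)) (g x :: _), List.mem_append] at hymem'
    -- The ball `y` stays when `x` and `z` leave, so it is read after both of them and cannot lie
    -- between them.
    have hydrop := hymem'.resolve_left fun h => by
      have := htake _ ht y h
      omega
    have hR := (List.pairwise_append.1 hpw).2.2
    have h1 := hR x (hg x hx).2 y hydrop
    have h2 := hR z (by have := (hg z hz).2; rwa [← hxz] at this) y hydrop
    revert h1 h2
    cases χ (g x) <;> intro h1 h2 <;> simp only [Before] at h1 h2 <;> omega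
  · intro t ht
    have h1 := hstep t ht (hq t ht.le)
    have h2 := congrArg (List.filter fun x => g x = t) h1
    rw [← List.take_append_drop (p t) (t :: _), List.filter_append,
      List.filter_eq_self.2 (by
        intro x hx
        simpa using (htake t ht x hx).2),
      List.filter_eq_nil_iff.2 (by
        intro x hx
        have := hdrop t ht x hx
        simp
        omega), List.append_nil, List.filter_filter, Side.filter_read] at h2
    have h3 := congrArg List.length h2
    rw [Side.length_read, List.length_take, List.length_cons, Side.length_read,
      min_eq_left (hp t ht)] at h3
    rw [h3]
    congr 1
    apply List.filter_congr
    intro x _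
    simp
    omega

end BlockQueue

theorem List.Pairwise.rel_or_rel {α : Type*} {R : α → α → Prop} {l : List α} (h : l.Pairwise R)
    {a b : α} (ha : a ∈ l) (hb : b ∈ l) (hab : a ≠ b) : R a b ∨ R b a := by
  induction h with
  | nil => simp at ha
  | cons h1 _ ih =>
    rcases List.mem_cons.1 ha with rfl | ha' <;> rcases List.mem_cons.1 hb with rfl | hb'
    · exact absurd rfl hab
    · exact Or.inl (h1 b hb')
    · exact Or.inr (h1 a ha')
    · exact ih ha' hb'

/-! ### The output of deque-scenarios -/

namespace Deque

theorem insertBalls_eq {β : Type*} (h : Side) (p : ℕ) (b : β) (D : List β) :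
    insertBalls h p b D = h.read (List.replicate p b ++ h.read D) := by
  cases h <;> simp [insertBalls, Side.read]

theorem removeEnd_eq {β : Type*} (h : Side) (D : List β) :
    removeEnd h D = h.read (h.read D).tail := by
  cases h <;> simp [removeEnd, Side.read]

theorem endBall_eq {β : Type*} (h : Side) (D : List β) : endBall h D = (h.read D).head? := by
  cases h <;> simp [endBall, Side.read]

/-- The content of the deque pipe after `t` moves, with natural numbers as tags. -/
def pipe (χ : ℕ → Side) (p : ℕ → ℕ) : ℕ → List ℕ
  | 0 => []
  | t + 1 => (χ t).read (List.replicate (p t) t ++ (χ t).read (pipe χ p t)).tail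

/-- The content of the deque pipe after the insertion in the move `t`, read from the side `χ t`. -/
def filledPipe (χ : ℕ → Side) (p : ℕ → ℕ) (t : ℕ) : List ℕ :=
  List.replicate (p t) t ++ (χ t).read (pipe χ p t)

theorem map_val_content {n : ℕ} (χ : ℕ → Side) (p : ℕ → ℕ) (t : ℕ) (ht : t ≤ n) :
    (content (n := n) (fun k => p k) (fun k => χ k) t ht).map Fin.val = pipe χ p t := by
  induction t with
  | zero => rfl
  | succ t ih =>
    rw [content, pipe, ← ih (Nat.le_of_succ_le ht), removeEnd_eq, insertBalls_eq, Side.read_read,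
      Side.map_read, List.map_tail, List.map_append, List.map_replicate, Side.map_read]

theorem map_val_outputTag {n : ℕ} (χ : ℕ → Side) (p : ℕ → ℕ) (i : Fin n) :
    (outputTag (n := n) (fun k => p k) (fun k => χ k) i).map Fin.val =
      (filledPipe χ p i).head? := by
  rw [outputTag, filledPipe, ← map_val_content (n := n) χ p i i.isLt.le, endBall_eq,
    insertBalls_eq, Side.read_read, ← List.head?_map, List.map_append, List.map_replicate,
    Side.map_read]

theorem sum_Iic_fin {n : ℕ} (p : ℕ → ℕ) (i : Fin n) :
    ∑ j ∈ Finset.Iic i, p j = ∑ j ∈ Finset.range (i + 1), p j := by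
  refine Finset.sum_nbij Fin.val ?_ (Fin.val_injective.injOn) ?_ fun _ _ => rfl
  · intro j hj
    rw [Finset.mem_Iic, Fin.le_def] at hj
    rw [Finset.mem_range]
    omega
  · intro j hj
    rw [Finset.mem_coe, Finset.mem_range] at hj
    exact ⟨⟨j, by omega⟩, by rw [Finset.mem_coe, Finset.mem_Iic, Fin.le_def]; simp only; omega, rfl⟩

theorem isScenario_iff {n : ℕ} (p : ℕ → ℕ) :
    IsScenario (n := n) (fun k => p k) ↔
      (∀ t < n, t + 1 ≤ ∑ j ∈ Finset.range (t + 1), p j) ∧ ∑ j ∈ Finset.range n, p j = n := by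
  rw [IsScenario, Fin.sum_univ_eq_sum_range p n]
  refine and_congr_left fun _ => ⟨fun h t ht => ?_, fun h i => ?_⟩
  · simpa [sum_Iic_fin] using h ⟨t, ht⟩
  · simpa [sum_Iic_fin] using h i i.isLt

/-- The position of the time `x < n` in the order in which the left times increase, followed by the
right times in decreasing order. -/
def outputKey (n : ℕ) (χ : ℕ → Side) (x : ℕ) : ℤ :=
  match χ x with
  | Side.left => x
  | Side.right => 2 * n - x

/-- Here later times lie farther in, so this is the time-reversed form of `le_max_of_key`. -/
theorem min_le_of_outputKey {n : ℕ} {χ : ℕ → Side} {x y z : ℕ} (hx : x < n) (hy : y < n)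
    (hz : z < n) (h1 : outputKey n χ x < outputKey n χ y)
    (h2 : outputKey n χ y < outputKey n χ z) : min x z ≤ y := by
  unfold outputKey at h1 h2
  cases hx : χ x <;> cases hy : χ y <;> cases hz : χ z <;> simp only [hx, hy, hz] at h1 h2 <;> omega

/-- The last `k` times before `n`, in the order given by `outputKey`. -/
def lastTimes (n : ℕ) (χ : ℕ → Side) : ℕ → List ℕ
  | 0 => []
  | k + 1 => (χ (n - 1 - k)).read ((n - 1 - k) :: (χ (n - 1 - k)).read (lastTimes n χ k))

/-- The times from `t` on and before `n`, in the order given by `outputKey`. -/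
def timesFrom (n : ℕ) (χ : ℕ → Side) (t : ℕ) : List ℕ := lastTimes n χ (n - t)

theorem timesFrom_self (n : ℕ) (χ : ℕ → Side) : timesFrom n χ n = [] := by
  simp [timesFrom, lastTimes]

theorem timesFrom_eq {n t : ℕ} (χ : ℕ → Side) (ht : t < n) :
    timesFrom n χ t = (χ t).read (t :: (χ t).read (timesFrom n χ (t + 1))) := by
  have h1 : n - t = (n - (t + 1)) + 1 := by omega
  have h2 : n - 1 - (n - (t + 1)) = t := by omega
  rw [timesFrom, h1, lastTimes, h2]
  rfl

theorem mem_timesFrom {n t x : ℕ} {χ : ℕ → Side} (ht : t ≤ n) :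
    x ∈ timesFrom n χ t ↔ t ≤ x ∧ x < n := by
  induction ht using Nat.decreasingInduction with
  | self =>
    rw [timesFrom_self]
    simp
  | of_succ t ht ih =>
    rw [timesFrom_eq χ ht]
    simp only [Side.mem_read, List.mem_cons, ih]
    omega

/-- The relation that `x` is met before `y` when times are read from the side `h` in the order given
by `outputKey`. -/
def OutputBefore (n : ℕ) (χ : ℕ → Side) (h : Side) (x y : ℕ) : Prop :=
  match h with
  | Side.left => outputKey n χ x < outputKey n χ y
  | Side.right => outputKey n χ y < outputKey n χ x

theorem pairwise_read_timesFrom {n t : ℕ} (χ : ℕ → Side) (h : Side) (ht : t ≤ n) :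
    (h.read (timesFrom n χ t)).Pairwise (OutputBefore n χ h) := by
  have main : (timesFrom n χ t).Pairwise fun x y => outputKey n χ x < outputKey n χ y := by
    induction ht using Nat.decreasingInduction with
    | self =>
      rw [timesFrom_self]
      exact List.Pairwise.nil
    | of_succ t ht ih =>
      rw [timesFrom_eq χ ht]
      rcases h : χ t
      · refine List.pairwise_cons.2 ⟨fun x hx => ?_, ih⟩
        have := (mem_timesFrom ht).1 hx
        unfold outputKey
        rw [h]
        rcases χ x <;> simp only <;> omega
      · simp only [Side.read, List.reverse_cons, List.reverse_reverse]
        refine List.pairwise_append.2 ⟨ih, List.pairwise_singleton _ _, fun x hx y hy => ?_⟩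
        rw [List.mem_singleton] at hy
        subst hy
        have := (mem_timesFrom ht).1 hx
        unfold outputKey
        rw [h]
        rcases χ x <;> simp only <;> omega
  cases h
  · exact main
  · exact List.pairwise_reverse.2 main

/-- The function that sends each time before `n` to the smallest time in its block, for a partition
which is non-crossing with respect to the order given by `outputKey`. -/
structure IsOutputTag (n : ℕ) (χ : ℕ → Side) (g : ℕ → ℕ) : Prop where
  tag_le : ∀ x < n, g x ≤ x
  tag_tag : ∀ x < n, g (g x) = g x
  convex : ∀ x < n, ∀ y < n, ∀ z < n, outputKey n χ x < outputKey n χ y →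
    outputKey n χ y < outputKey n χ z → g x = g z → g x ≤ g y

theorem filter_lt_succ_eq_append (g : ℕ → ℕ) (t : ℕ) (l : List ℕ)
    (h : l.Pairwise fun x y => g y = t → ¬ g x < t) :
    l.filter (fun x => g x < t + 1) =
      l.filter (fun x => g x = t) ++ l.filter (fun x => g x < t) := by
  induction l with
  | nil => rfl
  | cons x l ih =>
    obtain ⟨h1, h2⟩ := List.pairwise_cons.1 h
    rcases lt_trichotomy (g x) t with hx | hx | hx
    · rw [List.filter_cons_of_pos (by simp; omega), List.filter_cons_of_neg (by simpa using hx.ne),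
        List.filter_cons_of_pos (by simpa using hx), ih h2]
      have : l.filter (fun x => g x = t) = [] := by
        rw [List.filter_eq_nil_iff]
        intro y hy
        simpa using fun hyt => h1 y hy hyt hx
      rw [this]
      rfl
    · rw [List.filter_cons_of_pos (by simp; omega), List.filter_cons_of_pos (by simpa using hx),
        List.filter_cons_of_neg (by simp; omega), ih h2, List.cons_append]
    · rw [List.filter_cons_of_neg (by simp; omega), List.filter_cons_of_neg (by simpa using hx.ne'),
        List.filter_cons_of_neg (by simp; omega), ih h2]

theorem length_pipe_succ {χ : ℕ → Side} {p : ℕ → ℕ} {t : ℕ} (h : filledPipe χ p t ≠ []) :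
    (pipe χ p (t + 1)).length + 1 = p t + (pipe χ p t).length := by
  have h1 : (filledPipe χ p t).length = p t + (pipe χ p t).length := by
    simp [filledPipe]
  have h2 := List.length_pos_of_ne_nil h
  have h3 : (pipe χ p (t + 1)).length = (filledPipe χ p t).length - 1 := by
    simp [pipe, filledPipe]
  omega

/-- A move with a nonempty pipe takes out exactly one ball. This translates between the inequalities
of a scenario and the pipe never running dry. -/
theorem length_pipe_add {χ : ℕ → Side} {p : ℕ → ℕ} {t : ℕ}
    (h : ∀ s < t, filledPipe χ p s ≠ []) :
    (pipe χ p t).length + t = ∑ j ∈ Finset.range t, p j := by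
  induction t with
  | zero => rfl
  | succ t ih =>
    rw [Finset.sum_range_succ, ← ih fun s hs => h s (by omega)]
    have := length_pipe_succ (h t (by omega))
    omega

/-- The scenario in which the block `V` is inserted at the time `min V` has the output-time
partition that one expects. -/
theorem IsOutputTag.exists_scenario {n : ℕ} {χ : ℕ → Side} {g : ℕ → ℕ} (hg : IsOutputTag n χ g) :
    ∃ p : ℕ → ℕ, IsScenario (n := n) (fun k => p k) ∧
      ∀ t < n, (filledPipe χ p t).head? = some (g t) := by
  set p : ℕ → ℕ := fun s => ((timesFrom n χ s).filter fun x => g x = s).length with hp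
  -- The pipe before the move `t` is to hold one ball for each future time whose block is already
  -- open, arranged by `outputKey`. The move inserts the block that opens at `t` next to the end,
  -- and then the ball for the time `t` leaves.
  have step : ∀ t < n, pipe χ p t = ((timesFrom n χ t).filter fun x => g x < t).map g →
      filledPipe χ p t = g t ::
        (χ t).read (((timesFrom n χ (t + 1)).filter fun x => g x < t + 1).map g) := by
    intro t ht hc
    have e1 : filledPipe χ p t =
        (((χ t).read (timesFrom n χ t)).filter fun x => g x < t + 1).map g := by
      rw [filter_lt_succ_eq_append, List.map_append, filledPipe, hc]
      · congr 1
        · symm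
          rw [List.eq_replicate_iff]
          constructor
          · rw [List.length_map, Side.filter_read, Side.length_read]
          · intro y hy
            obtain ⟨x, hx, rfl⟩ := List.mem_map.1 hy
            simpa using (List.mem_filter.1 hx).2
        · rw [Side.filter_read, Side.map_read]
      · have hU := pairwise_read_timesFrom χ (χ t) ht.le
        have hmem : ∀ x ∈ (χ t).read (timesFrom n χ t), x < n := by
          intro x hx
          rw [Side.mem_read, mem_timesFrom ht.le] at hx
          exact hx.2
        have hhead : ∀ x ∈ (χ t).read (timesFrom n χ t), x = t ∨ OutputBefore n χ (χ t) t x := by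
          rw [timesFrom_eq χ ht, Side.read_read] at hU ⊢
          intro x hx
          rcases List.mem_cons.1 hx with rfl | hx
          · exact Or.inl rfl
          · exact Or.inr ((List.pairwise_cons.1 hU).1 x hx)
        refine hU.imp_of_mem fun {x y} hx hy hxy hgy hgx => ?_
        have hxn := hmem x hx
        have hyn := hmem y hy
        have hgt : g t = t := by
          have := hg.tag_tag y hyn
          rwa [hgy] at this
        rcases hhead x hx with rfl | hx'
        · omega
        · have : t ≤ g x := by
            revert hx' hxy
            cases χ t <;> intro hxy hx'
            · have := hg.convex t ht x hxn y hyn hx' hxy (by omega)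
              omega
            · have := hg.convex y hyn x hxn t ht hxy hx' (by omega)
              omega
          omega
    rw [e1, timesFrom_eq χ ht, Side.read_read, List.filter_cons_of_pos, List.map_cons,
      Side.filter_read, Side.map_read]
    have := hg.tag_le t ht
    simp
    omega
  have hc : ∀ t ≤ n, pipe χ p t = ((timesFrom n χ t).filter fun x => g x < t).map g := by
    intro t
    induction t with
    | zero =>
      intro _
      simp [pipe]
    | succ t ih =>
      intro ht
      have := step t ht (ih (by omega))
      rw [filledPipe] at this
      rw [pipe, this, List.tail_cons, Side.read_read]
  have hf : ∀ t < n, (filledPipe χ p t).head? = some (g t) := by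
    intro t ht
    rw [step t ht (hc t ht.le), List.head?_cons]
  refine ⟨p, (isScenario_iff p).2 ?_, hf⟩
  have hne : ∀ t < n, filledPipe χ p t ≠ [] := by
    intro t ht h
    have := hf t ht
    rw [h] at this
    simp at this
  refine ⟨fun t ht => ?_, ?_⟩
  · rw [← length_pipe_add (χ := χ) fun s hs => hne s (by omega)]
    omega
  · rw [← length_pipe_add (χ := χ) hne, hc n le_rfl, timesFrom_self]
    simp

/-- The output tags of a deque-scenario. -/
theorem exists_isOutputTag {n : ℕ} {χ : ℕ → Side} {p : ℕ → ℕ}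
    (hp : IsScenario (n := n) (fun k => p k)) :
    ∃ g, IsOutputTag n χ g ∧ ∀ t < n, (filledPipe χ p t).head? = some (g t) := by
  obtain ⟨hp1, hp2⟩ := (isScenario_iff p).1 hp
  have hne : ∀ t < n, filledPipe χ p t ≠ [] := by
    intro t
    induction t using Nat.strong_induction_on with
    | _ t ih =>
      intro ht h
      have h1 := length_pipe_add (χ := χ) (p := p) (t := t) fun s hs => ih s hs (by omega)
      have h2 := hp1 t ht
      rw [Finset.sum_range_succ] at h2
      have h3 := congrArg List.length h
      simp only [filledPipe, List.length_append, List.length_replicate, Side.length_read,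
        List.length_nil] at h3
      omega
  have hnil : pipe χ p n = [] := by
    have := length_pipe_add hne
    rw [hp2] at this
    exact List.length_eq_zero_iff.1 (by omega)
  -- The default `0` is never used for `t < n`, by `hne`.
  set g : ℕ → ℕ := fun t => (filledPipe χ p t).headD 0 with hg
  have hcons : ∀ t < n, filledPipe χ p t = g t :: (χ t).read (pipe χ p (t + 1)) := by
    intro t ht
    have e : pipe χ p (t + 1) = (χ t).read (filledPipe χ p t).tail := rfl
    rw [e, Side.read_read]
    simp only [hg]
    cases h : filledPipe χ p t with
    | nil => exact absurd h (hne t ht)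
    | cons a l => rfl
  have hlt : ∀ t ≤ n, ∀ x ∈ pipe χ p t, x < t := by
    intro t
    induction t with
    | zero => intro _ x hx; simp [pipe] at hx
    | succ t ih =>
      intro ht x hx
      rw [pipe, Side.mem_read] at hx
      have := List.mem_of_mem_tail hx
      rw [List.mem_append, Side.mem_read, List.mem_replicate] at this
      rcases this with h | h
      · omega
      · have := ih (by omega) x h
        omega
  have hle : ∀ t < n, g t ≤ t := by
    intro t ht
    have : g t ∈ filledPipe χ p t := by
      rw [hcons t ht]
      exact List.mem_cons_self
    rw [filledPipe, List.mem_append, Side.mem_read, List.mem_replicate] at this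
    rcases this with h | h
    · omega
    · exact (hlt t ht.le _ h).le
  have hstep : ∀ t < n,
      pipe χ p (t + 1) = ((timesFrom n χ (t + 1)).filter fun x => g x < t + 1).map g →
      filledPipe χ p t = (((χ t).read (timesFrom n χ t)).filter fun x => g x < t + 1).map g := by
    intro t ht h
    have := hle t ht
    rw [hcons t ht, h, timesFrom_eq χ ht, Side.read_read, List.filter_cons_of_pos, List.map_cons,
      Side.filter_read, Side.map_read]
    simp
    omega
  have hc : ∀ t ≤ n, pipe χ p t = ((timesFrom n χ t).filter fun x => g x < t).map g := by
    intro t ht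
    -- The content is reconstructed backwards from the empty pipe at the time `n`: the ball that
    -- left is put back, and then the balls inserted by the move, those with tag `t`, are filtered
    -- out.
    induction ht using Nat.decreasingInduction with
    | self => rw [hnil, timesFrom_self]; rfl
    | of_succ t ht ih =>
      have h1 := hstep t ht ih
      have h2 := congrArg (List.filter fun x => x < t) h1
      rw [filledPipe, List.filter_append, List.filter_eq_nil_iff.2 (by
          intro x hx
          rw [List.mem_replicate] at hx
          simp [hx.2]),
        List.filter_eq_self.2 (by
          intro x hx
          rw [Side.mem_read] at hx
          simpa using hlt t ht.le x hx), List.nil_append, List.filter_map, List.filter_filter] at h2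
      have h3 := congrArg (χ t).read h2
      rw [Side.read_read, Side.filter_read, Side.map_read, Side.read_read] at h3
      rw [h3]
      congr 1
      apply List.filter_congr
      intro x _
      simp
      omega
  have hfilled : ∀ t < n,
      filledPipe χ p t = (((χ t).read (timesFrom n χ t)).filter fun x => g x < t + 1).map g :=
    fun t ht => hstep t ht (hc (t + 1) ht)
  refine ⟨g, ⟨hle, fun x hx => ?_, ?_⟩, fun t ht => by rw [hcons t ht, List.head?_cons]⟩
  · have hs : g x < n := (hle x hx).trans_lt hx
    have hmem : g x ∈ filledPipe χ p (g x) := by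
      rw [hfilled _ hs, List.mem_map]
      refine ⟨x, List.mem_filter.2 ⟨?_, by simp⟩, rfl⟩
      rw [Side.mem_read, mem_timesFrom hs.le]
      exact ⟨hle x hx, hx⟩
    -- A ball with tag `g x` is present right after the insertion in the move `g x`, while older
    -- balls have smaller tags. So that move inserts something, and the first ball to leave is one
    -- of its own.
    have hrep : p (g x) ≠ 0 := by
      intro h0
      rw [filledPipe, h0, List.replicate_zero, List.nil_append, Side.mem_read] at hmem
      exact lt_irrefl _ (hlt _ hs.le _ hmem)
    obtain ⟨k, hk⟩ := Nat.exists_eq_succ_of_ne_zero hrep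
    have := hcons _ hs
    rw [filledPipe, hk, List.replicate_succ, List.cons_append, List.cons.injEq] at this
    exact this.1.symm
  · intro x hx y hy z hz hxy hyz hxz
    by_contra hgy
    have hs : g x < n := (hle x hx).trans_lt hx
    -- Freshly inserted balls precede all older ones. If `g y < g x`, then `y` is read after both
    -- `x` and `z`, and cannot lie between them.
    have hpw : (filledPipe χ p (g x)).Pairwise fun a b => b = g x → a = g x := by
      rw [filledPipe]
      refine List.pairwise_append.2 ⟨?_, ?_, ?_⟩
      · exact List.pairwise_replicate.2 (Or.inr id)
      · refine List.pairwise_of_forall_mem_list fun a _ b hb h => ?_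
        rw [Side.mem_read] at hb
        exact absurd h (hlt _ hs.le _ hb).ne
      · intro a ha b _ _
        exact (List.mem_replicate.1 ha).2
    rw [hfilled _ hs, List.pairwise_map] at hpw
    have hpw' := (pairwise_read_timesFrom χ (χ (g x)) hs.le).filter fun x' => g x' < g x + 1
    have hboth := hpw.and hpw'
    have hmem : ∀ w, g x ≤ w → w < n → g w < g x + 1 →
        w ∈ ((χ (g x)).read (timesFrom n χ (g x))).filter fun x' => g x' < g x + 1 := by
      intro w h1 h2 h3
      refine List.mem_filter.2 ⟨?_, by simpa using h3⟩
      rw [Side.mem_read, mem_timesFrom hs.le]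
      exact ⟨h1, h2⟩
    have hmin := min_le_of_outputKey hx hy hz hxy hyz
    have hxx := hle x hx
    have hzz := hle z hz
    have hx' := hmem x hxx hx (by omega)
    have hy' := hmem y (by omega) hy (by omega)
    have hz' := hmem z (by omega) hz (by omega)
    have hyx : y ≠ x := by
      rintro rfl
      exact lt_irrefl _ hxy
    have hyz' : y ≠ z := by
      rintro rfl
      exact lt_irrefl _ hyz
    have h1 := ((hboth.rel_or_rel hy' hx' hyx).resolve_left fun h => hgy (h.1 rfl).ge).2
    have h2 := ((hboth.rel_or_rel hy' hz' hyz').resolve_left fun h => hgy (h.1 hxz.symm).ge).2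
    revert h1 h2
    cases χ (g x) <;> intro h1 h2 <;> simp only [OutputBefore] at h1 h2 <;> omega

end Deque

/-! ### Non-crossing partitions -/

/-- The kernel of `g`, on the numbers less than `n`, is non-crossing with respect to the order given
by `k`. -/
def IsNonCrossing {γ : Type*} (n : ℕ) (k : ℕ → ℤ) (g : ℕ → γ) : Prop :=
  ∀ a < n, ∀ b < n, ∀ c < n, ∀ d < n, k a < k b → k b < k c → k c < k d →
    g a = g c → g b = g d → g a = g b

theorem IsNonCrossing.congr {γ δ : Type*} {n : ℕ} {k : ℕ → ℤ} {g : ℕ → γ} {g' : ℕ → δ}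
    (h : IsNonCrossing n k g) (hgg' : ∀ x < n, ∀ y < n, g x = g y ↔ g' x = g' y) :
    IsNonCrossing n k g' := by
  intro a ha b hb c hc d hd hab hbc hcd hac hbd
  exact (hgg' a ha b hb).1 (h a ha b hb c hc d hd hab hbc hcd ((hgg' a ha c hc).2 hac)
    ((hgg' b hb d hd).2 hbd))

open BlockQueue Deque

/-- The orders given by `outputKey` and by `key` differ by a reflection and a rotation. -/
theorem isNonCrossing_outputKey_iff {γ : Type*} {n : ℕ} {χ : ℕ → Side} {g : ℕ → γ} :
    IsNonCrossing n (outputKey n χ) g ↔ IsNonCrossing n (key χ) g := by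
  constructor <;> intro h a ha b hb c hc d hd hab hbc hcd hac hbd
  -- The four quadruples are the reversal of `(a, b, c, d)` and its cyclic rotations. For each
  -- possible pattern of sides, one of them is increasing for the other order.
  · have h0 := h d hd c hc b hb a ha
    have h1 := h a ha d hd c hc b hb
    have h2 := h b hb a ha d hd c hc
    have h3 := h c hc b hb a ha d hd
    unfold outputKey at h0 h1 h2 h3
    unfold key at hab hbc hcd
    cases xa : χ a <;> cases xb : χ b <;> cases xc : χ c <;> cases xd : χ d <;>
      simp only [xa, xb, xc, xd] at h0 h1 h2 h3 hab hbc hcd <;>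
      first
      | omega
      | exact hac.trans ((h0 (by omega) (by omega) (by omega) hbd.symm hac.symm).symm.trans hbd.symm)
      | exact (h1 (by omega) (by omega) (by omega) hac hbd.symm).trans hbd.symm
      | exact (h2 (by omega) (by omega) (by omega) hbd hac).symm
      | exact hac.trans (h3 (by omega) (by omega) (by omega) hac.symm hbd)
  · have h0 := h d hd c hc b hb a ha
    have h1 := h a ha d hd c hc b hb
    have h2 := h b hb a ha d hd c hc
    have h3 := h c hc b hb a ha d hd
    unfold key at h0 h1 h2 h3
    unfold outputKey at hab hbc hcd
    cases xa : χ a <;> cases xb : χ b <;> cases xc : χ c <;> cases xd : χ d <;>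
      simp only [xa, xb, xc, xd] at h0 h1 h2 h3 hab hbc hcd <;>
      first
      | omega
      | exact hac.trans ((h0 (by omega) (by omega) (by omega) hbd.symm hac.symm).symm.trans hbd.symm)
      | exact (h1 (by omega) (by omega) (by omega) hac hbd.symm).trans hbd.symm
      | exact (h2 (by omega) (by omega) (by omega) hbd hac).symm
      | exact hac.trans (h3 (by omega) (by omega) (by omega) hac.symm hbd)

theorem BlockQueue.IsBlockTag.isNonCrossing {χ : ℕ → Side} {n : ℕ} {g : ℕ → ℕ}
    (hg : IsBlockTag χ n g) : IsNonCrossing n (key χ) g := by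
  intro a ha b hb c hc d hd hab hbc hcd hac hbd
  have h1 := hg.convex a ha b hb c hc hab hbc hac
  have h2 := hg.convex b hb c hc d hd hbc hcd hbd
  omega

theorem Deque.IsOutputTag.isNonCrossing {χ : ℕ → Side} {n : ℕ} {g : ℕ → ℕ}
    (hg : IsOutputTag n χ g) : IsNonCrossing n (outputKey n χ) g := by
  intro a ha b hb c hc d hd hab hbc hcd hac hbd
  have h1 := hg.convex a ha b hb c hc hab hbc hac
  have h2 := hg.convex b hb c hc d hd hbc hcd hbd
  omega

theorem BlockQueue.isBlockTag_of_isNonCrossing {χ : ℕ → Side} {n : ℕ} {g : ℕ → ℕ}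
    (h1 : ∀ x < n, x ≤ g x) (h2 : ∀ x < n, g x < n) (h3 : ∀ x < n, g (g x) = g x)
    (h : IsNonCrossing n (key χ) g) : IsBlockTag χ n g := by
  refine ⟨h1, h2, h3, fun x hx y hy z hz hxy hyz hxz => ?_⟩
  by_contra hlt
  have hx1 := h1 x hx
  have hz1 := h1 z hz
  have hm := h2 y hy
  have hmy := h3 y hy
  -- If `g x < g y`, then `g y` is later than both `x` and `z`, hence outside the interval between
  -- them. The pairs `g y, y` and `x, z` would then cross.
  have hout : key χ (g y) < key χ x ∨ key χ z < key χ (g y) := by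
    unfold key at hxy hyz ⊢
    cases xa : χ x <;> cases xc : χ z <;> cases χ (g y) <;>
      simp only [xa, xc] at hxy hyz ⊢ <;> omega
  rcases hout with ho | ho
  · have := h _ hm x hx y hy z hz ho hxy hyz hmy hxz
    omega
  · have := h x hx y hy z hz _ hm hxy hyz ho hxz hmy.symm
    omega

theorem Deque.isOutputTag_of_isNonCrossing {χ : ℕ → Side} {n : ℕ} {g : ℕ → ℕ}
    (h1 : ∀ x < n, g x ≤ x) (h3 : ∀ x < n, g (g x) = g x)
    (h : IsNonCrossing n (outputKey n χ) g) : IsOutputTag n χ g := by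
  refine ⟨h1, h3, fun x hx y hy z hz hxy hyz hxz => ?_⟩
  by_contra hlt
  have hx1 := h1 x hx
  have hz1 := h1 z hz
  have hm : g y < n := (h1 y hy).trans_lt hy
  have hmy := h3 y hy
  have hout : outputKey n χ (g y) < outputKey n χ x ∨ outputKey n χ z < outputKey n χ (g y) := by
    unfold outputKey at hxy hyz ⊢
    cases xa : χ x <;> cases xc : χ z <;> cases χ (g y) <;>
      simp only [xa, xc] at hxy hyz ⊢ <;> omega
  rcases hout with ho | ho
  · have := h _ hm x hx y hy z hz ho hxy hyz hmy hxz
    omega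
  · have := h x hx y hy z hz _ hm hxy hyz ho hxz hmy.symm
    omega

/-! ### Blocks and their extreme elements -/

section Blocks

variable {n : ℕ} (π : Finpartition (Finset.univ : Finset (Fin n)))

theorem nonempty_part (x : Fin n) : (π.part x).Nonempty :=
  ⟨x, π.mem_part (Finset.mem_univ x)⟩

/-- The largest element of the block of `x`. -/
def blockMax (x : ℕ) : ℕ :=
  if h : x < n then (π.part ⟨x, h⟩).max' (nonempty_part π _) else x

/-- The smallest element of the block of `x`. -/
def blockMin (x : ℕ) : ℕ :=
  if h : x < n then (π.part ⟨x, h⟩).min' (nonempty_part π _) else x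

theorem blockMax_val (x : Fin n) : blockMax π x = (π.part x).max' (nonempty_part π x) := by
  rw [blockMax, dif_pos x.isLt]

theorem blockMin_val (x : Fin n) : blockMin π x = (π.part x).min' (nonempty_part π x) := by
  rw [blockMin, dif_pos x.isLt]

variable {π}

theorem part_eq_part_of_mem {x y : Fin n} (h : y ∈ π.part x) : π.part y = π.part x :=
  π.part_eq_of_mem (π.part_mem.2 (Finset.mem_univ x)) h

theorem blockMax_eq_iff {x y : Fin n} : blockMax π x = blockMax π y ↔ π.part x = π.part y := by
  rw [blockMax_val, blockMax_val]
  constructor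
  · intro h
    rw [← part_eq_part_of_mem ((π.part x).max'_mem (nonempty_part π x)),
      ← part_eq_part_of_mem ((π.part y).max'_mem (nonempty_part π y)), Fin.ext h]
  · intro h
    simp only [h]

theorem blockMin_eq_iff {x y : Fin n} : blockMin π x = blockMin π y ↔ π.part x = π.part y := by
  rw [blockMin_val, blockMin_val]
  constructor
  · intro h
    rw [← part_eq_part_of_mem ((π.part x).min'_mem (nonempty_part π x)),
      ← part_eq_part_of_mem ((π.part y).min'_mem (nonempty_part π y)), Fin.ext h]
  · intro h
    simp only [h]

theorem le_blockMax (x : Fin n) : (x : ℕ) ≤ blockMax π x := by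
  rw [blockMax_val]
  exact Fin.le_def.1 (Finset.le_max' _ _ (π.mem_part (Finset.mem_univ x)))

theorem blockMin_le (x : Fin n) : blockMin π x ≤ (x : ℕ) := by
  rw [blockMin_val]
  exact Fin.le_def.1 (Finset.min'_le _ _ (π.mem_part (Finset.mem_univ x)))

theorem blockMax_lt (x : Fin n) : blockMax π x < n := by
  rw [blockMax_val]
  exact Fin.isLt _

theorem blockMax_blockMax (x : Fin n) : blockMax π (blockMax π x) = blockMax π x := by
  rw [blockMax_val π x]
  exact (blockMax_eq_iff.2 (part_eq_part_of_mem ((π.part x).max'_mem (nonempty_part π x)))).trans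
    (blockMax_val π x)

theorem blockMin_blockMin (x : Fin n) : blockMin π (blockMin π x) = blockMin π x := by
  rw [blockMin_val π x]
  exact (blockMin_eq_iff.2 (part_eq_part_of_mem ((π.part x).min'_mem (nonempty_part π x)))).trans
    (blockMin_val π x)

theorem finpartition_eq_of_part_eq {π π' : Finpartition (Finset.univ : Finset (Fin n))}
    (h : ∀ x, π.part x = π'.part x) : π = π' := by
  have aux : ∀ {π π' : Finpartition (Finset.univ : Finset (Fin n))},
      (∀ x, π.part x = π'.part x) → π.parts ⊆ π'.parts := by
    intro π π' h V hV
    obtain ⟨x, hx⟩ := π.nonempty_of_mem_parts hV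
    rw [← π.part_eq_of_mem hV hx, h]
    exact π'.part_mem.2 (Finset.mem_univ x)
  exact Finpartition.ext ((aux h).antisymm (aux fun x => (h x).symm))

theorem mem_part_outputTimePartition {p : Fin n → ℕ} {χ : Fin n → Side} {x y : Fin n} :
    y ∈ (outputTimePartition p χ).part x ↔ outputTag p χ x = outputTag p χ y := by
  classical
  rw [outputTimePartition, Finpartition.mem_part_ofSetoid_iff_rel]
  rfl

theorem mem_part_iff {x y : Fin n} : y ∈ π.part x ↔ π.part x = π.part y := by
  refine ⟨fun h => (part_eq_part_of_mem h).symm, fun h => ?_⟩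
  rw [h]
  exact π.mem_part (Finset.mem_univ y)

/-- The output-time partitions are the non-crossing partitions for the order given by `key`. -/
theorem mem_partitions_iff {χ : ℕ → Side} :
    π ∈ Deque.partitions (fun k : Fin n => χ k) ↔ IsBlockTag χ n (blockMax π) := by
  have hmax : ∀ {f : ℕ → ℕ}, (∀ x y : Fin n, f x = f y ↔ π.part x = π.part y) →
      ∀ x < n, ∀ y < n, f x = f y ↔ blockMax π x = blockMax π y := by
    intro f hf x hx y hy
    exact (hf ⟨x, hx⟩ ⟨y, hy⟩).trans (blockMax_eq_iff (x := ⟨x, hx⟩) (y := ⟨y, hy⟩)).symm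
  have htag : ∀ {p g : ℕ → ℕ}, (∀ t < n, (filledPipe χ p t).head? = some (g t)) →
      ∀ x y : Fin n, (outputTag (fun k : Fin n => p k) (fun k => χ k) x =
        outputTag (fun k : Fin n => p k) (fun k => χ k) y ↔ g x = g y) := by
    intro p g hpg x y
    rw [← (Option.map_injective Fin.val_injective).eq_iff, map_val_outputTag, map_val_outputTag,
      hpg x x.isLt, hpg y y.isLt, Option.some_inj]
  simp only [Deque.partitions, Finset.mem_filter, Finset.mem_univ, true_and]
  constructor
  · rintro ⟨p, hp, rfl⟩
    -- The values outside `Fin n` play no role.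
    obtain ⟨p, rfl⟩ : ∃ p' : ℕ → ℕ, (fun k : Fin n => p' k) = p :=
      ⟨fun k => if h : k < n then p ⟨k, h⟩ else 0, by funext k; simp⟩
    obtain ⟨g, hg, hpg⟩ := exists_isOutputTag (χ := χ) hp
    refine isBlockTag_of_isNonCrossing (fun x hx => le_blockMax ⟨x, hx⟩)
      (fun x hx => blockMax_lt ⟨x, hx⟩) (fun x hx => blockMax_blockMax ⟨x, hx⟩) ?_
    refine (isNonCrossing_outputKey_iff.1 hg.isNonCrossing).congr (hmax fun x y => ?_)
    rw [← htag hpg, ← mem_part_outputTimePartition, mem_part_iff]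
  · intro h
    have hmin : IsOutputTag n χ (blockMin π) := by
      refine isOutputTag_of_isNonCrossing (fun x hx => blockMin_le ⟨x, hx⟩)
        (fun x hx => blockMin_blockMin ⟨x, hx⟩) ?_
      refine (isNonCrossing_outputKey_iff.2 h.isNonCrossing).congr fun x hx y hy => ?_
      exact (hmax (fun _ _ => blockMin_eq_iff) x hx y hy).symm
    obtain ⟨p, hp, hpg⟩ := hmin.exists_scenario
    refine ⟨_, hp, finpartition_eq_of_part_eq fun x => ?_⟩
    ext y
    rw [mem_part_outputTimePartition, htag hpg, blockMin_eq_iff, mem_part_iff]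

end Blocks

/-! ### The word attached to a block. -/

/-- The word of indices that belongs to `χ` when the last letter of `χ` is `h`. -/
def cumulantWord {n : ℕ} (χ : Fin n → Side) (h : Side) : List (Fin n) :=
  match h with
  | Side.left => (occurrences χ Side.right).reverse ++ occurrences χ Side.left
  | Side.right => (occurrences χ Side.left).reverse ++ occurrences χ Side.right

section BlockWords

variable {n : ℕ} {π : Finpartition (Finset.univ : Finset (Fin n))} {V : Finset (Fin n)}

theorem blockMax_of_mem (hV : V ∈ π.parts) {x : Fin n} (hx : x ∈ V) :
    blockMax π x = V.max' ⟨x, hx⟩ := by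
  rw [blockMax_val]
  simp only [π.part_eq_of_mem hV hx]

theorem mem_iff_blockMax (hV : V ∈ π.parts) (hne : V.Nonempty) (x : Fin n) :
    x ∈ V ↔ blockMax π x = V.max' hne := by
  refine ⟨blockMax_of_mem hV, fun h => ?_⟩
  rw [← blockMax_of_mem hV (V.max'_mem hne), blockMax_eq_iff,
    π.part_eq_of_mem hV (V.max'_mem hne)] at h
  rw [← h]
  exact π.mem_part (Finset.mem_univ x)

/-- Both lists are strictly increasing with the same members. This passes from positions inside the
block to times. -/
theorem map_occurrences_restrict (χ : ℕ → Side) (hV : V ∈ π.parts) (hne : V.Nonempty) (h : Side) :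
    (occurrences (LRCumulant.restrict (fun k : Fin n => χ k) V) h).map
        (fun k => ((V.orderEmbOfFin rfl k : Fin n) : ℕ)) =
      ((List.range (V.max' hne + 1)).filter fun x => χ x = h).filter
        fun x => blockMax π x = V.max' hne := by
  refine List.Pairwise.eq_of_mem_iff (r := (· < ·)) ?_ ?_ fun x => ?_
  · rw [List.pairwise_map]
    refine ((List.pairwise_lt_finRange _).filter _).imp fun {a b} hab => ?_
    exact (V.orderEmbOfFin rfl).strictMono hab
  · exact (List.pairwise_lt_range.filter _).filter _
  · simp only [occurrences, List.mem_map, List.mem_filter, List.mem_finRange, true_and,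
      decide_eq_true_eq, List.mem_range, LRCumulant.restrict]
    constructor
    · rintro ⟨k, hk, rfl⟩
      have hmem := V.orderEmbOfFin_mem rfl k
      exact ⟨⟨Nat.lt_succ_of_le (Fin.le_def.1 (V.le_max' _ hmem)), of_decide_eq_true hk⟩,
        (mem_iff_blockMax hV hne _).1 hmem⟩
    · rintro ⟨⟨hx, hχ⟩, hmax⟩
      have hxn : x < n := by
        have := (V.max' hne).isLt
        omega
      have hxV := (mem_iff_blockMax hV hne ⟨x, hxn⟩).2 hmax
      have : (⟨x, hxn⟩ : Fin n) ∈ Set.range (V.orderEmbOfFin rfl) := by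
        rw [Finset.range_orderEmbOfFin]
        exact hxV
      obtain ⟨k, hk⟩ := this
      have hk' := congrArg Fin.val hk
      refine ⟨k, ?_, hk'⟩
      exact decide_eq_true ((congrArg χ hk').trans hχ)

theorem map_cumulantWord_restrict (χ : ℕ → Side) (hV : V ∈ π.parts) (hne : V.Nonempty) (h : Side) :
    (cumulantWord (LRCumulant.restrict (fun k : Fin n => χ k) V) h).map
        (fun k => ((V.orderEmbOfFin rfl k : Fin n) : ℕ)) =
      (h.read ((timeList χ (V.max' hne + 1)).filter
        fun x => blockMax π x = V.max' hne)).reverse := by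
  rw [timeList_eq, List.filter_append, List.filter_reverse, ← map_occurrences_restrict χ hV hne,
    ← map_occurrences_restrict χ hV hne]
  cases h <;> simp [cumulantWord, Side.read, List.map_reverse]

end BlockWords

/-! ### The bijection between partitions and runs that empty the queue. -/

/-- The sequence of moves which produces the partition `π`. -/
def blockMoves {n : ℕ} (χ : ℕ → Side) (π : Finpartition (Finset.univ : Finset (Fin n)))
    (s : ℕ) : ℕ :=
  if s < n then ((timeList χ (s + 1)).filter fun x => blockMax π x = s).length else 0

section BlockMoves

variable {n : ℕ} {χ : ℕ → Side} {π : Finpartition (Finset.univ : Finset (Fin n))}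

theorem removed_blockMoves (hπ : IsBlockTag χ n (blockMax π)) {t : ℕ} (ht : t < n) :
    removed χ (blockMoves χ π) t =
      (χ t).read ((timeList χ (t + 1)).filter fun x => blockMax π x = t) :=
  (hπ.queue_eq fun _ hs => if_pos hs).2 t ht

theorem queue_blockMoves (hπ : IsBlockTag χ n (blockMax π)) :
    queue χ (blockMoves χ π) n = [] := by
  rw [(hπ.queue_eq (p := blockMoves χ π) fun _ hs => if_pos hs).1 n le_rfl, List.filter_eq_nil_iff]
  intro x hx
  have := hπ.tag_lt x (mem_timeList.1 hx)
  simpa using this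

theorem blockMoves_mem_admissible (hπ : IsBlockTag χ n (blockMax π)) :
    blockMoves χ π ∈ admissible χ n := by
  refine mem_admissible.2 ⟨fun s hs => ?_, fun s hs => if_neg (not_lt.2 hs)⟩
  have h1 := congrArg List.length (removed_blockMoves hπ hs)
  have h2 : blockMoves χ π s = ((timeList χ (s + 1)).filter fun x => blockMax π x = s).length :=
    if_pos hs
  rw [Side.length_read, ← h2, removed, List.length_take, List.length_cons, Side.length_read] at h1
  omega

theorem finpartition_eq_of_blockMax_eq {π' : Finpartition (Finset.univ : Finset (Fin n))}
    (h : ∀ x < n, blockMax π x = blockMax π' x) : π = π' := by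
  refine finpartition_eq_of_part_eq fun x => ?_
  ext y
  rw [mem_part_iff, mem_part_iff, ← blockMax_eq_iff, ← blockMax_eq_iff, h x x.isLt, h y y.isLt]

/-- The moves determine the lists of removed balls, and these lists are the blocks. -/
theorem blockMoves_injective {π' : Finpartition (Finset.univ : Finset (Fin n))}
    (hπ : IsBlockTag χ n (blockMax π)) (hπ' : IsBlockTag χ n (blockMax π'))
    (h : blockMoves χ π = blockMoves χ π') : π = π' := by
  refine finpartition_eq_of_blockMax_eq fun x hx => ?_
  have ht := hπ.tag_lt x hx
  have h1 := removed_blockMoves hπ ht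
  rw [h, removed_blockMoves hπ' ht] at h1
  have h2 : x ∈ (χ (blockMax π x)).read ((timeList χ (blockMax π x + 1)).filter
      fun y => blockMax π y = blockMax π x) := by
    rw [Side.mem_read, List.mem_filter, mem_timeList]
    exact ⟨Nat.lt_succ_of_le (hπ.le_tag x hx), by simp⟩
  rw [← h1, Side.mem_read, List.mem_filter] at h2
  exact (of_decide_eq_true h2.2).symm

theorem exists_blockMoves_eq {p : ℕ → ℕ} (hp : p ∈ admissible χ n) (hq : queue χ p n = []) :
    ∃ π : Finpartition (Finset.univ : Finset (Fin n)),
      IsBlockTag χ n (blockMax π) ∧ blockMoves χ π = p := by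
  classical
  obtain ⟨hp1, hp2⟩ := mem_admissible.1 hp
  obtain ⟨g, hg, hpg⟩ := exists_isBlockTag hp1 hq
  set π : Finpartition (Finset.univ : Finset (Fin n)) :=
    Finpartition.ofSetoid (Setoid.ker fun x : Fin n => g x) with hπ
  have hmem : ∀ x y : Fin n, y ∈ π.part x ↔ g x = g y := by
    intro x y
    rw [hπ, Finpartition.mem_part_ofSetoid_iff_rel]
    rfl
  have hmax : ∀ x < n, blockMax π x = g x := by
    intro x hx
    have h1 := blockMax_val π ⟨x, hx⟩
    refine h1.trans ?_
    have h2 : (π.part ⟨x, hx⟩).max' (nonempty_part π _) = ⟨g x, hg.tag_lt x hx⟩ := by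
      refine le_antisymm (Finset.max'_le _ _ _ fun y hy => ?_) (Finset.le_max' _ _ ?_)
      · rw [Fin.le_def]
        have := hg.le_tag y y.isLt
        rw [hmem] at hy
        exact this.trans hy.ge
      · rw [hmem]
        exact (hg.tag_tag x hx).symm
    rw [h2]
  refine ⟨π, ⟨?_, ?_, ?_, ?_⟩, ?_⟩
  · exact fun x hx => le_blockMax ⟨x, hx⟩
  · exact fun x hx => blockMax_lt ⟨x, hx⟩
  · exact fun x hx => blockMax_blockMax ⟨x, hx⟩
  · intro x hx y hy z hz
    rw [hmax x hx, hmax y hy, hmax z hz]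
    exact hg.convex x hx y hy z hz
  · funext s
    unfold blockMoves
    split_ifs with hs
    · rw [hpg s hs]
      congr 1
      apply List.filter_congr
      intro x hx
      rw [mem_timeList] at hx
      rw [hmax x (by omega)]
    · exact (hp2 s (not_lt.1 hs)).symm

end BlockMoves

/-! ### The moment-cumulant formula and the cumulants. -/

namespace Fock

variable {d : ℕ} (e : OrthonormalBasis (Fin d) ℂ (EuclideanSpace ℂ (Fin d)))

/-- The coefficient which is the `(ℓ, r)`-cumulant of the canonical operators. -/
noncomputable def cumulantCoeff (f g : NCPolynomial d) (n : ℕ) (χ : Fin n → Side)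
    (i : Fin n → Fin d) : ℂ :=
  if h : 0 < n then
    sideCoeff f g (χ ⟨n - 1, Nat.sub_lt h Nat.one_pos⟩)
      ((cumulantWord χ (χ ⟨n - 1, Nat.sub_lt h Nat.one_pos⟩)).map i)
  else 0

theorem sideCoeff_nil (f g : NCPolynomial d) (h : Side) : sideCoeff f g h [] = 1 := by
  cases h <;> simp [sideCoeff, symbolCoeff]

theorem cumulantCoeff_restrict (f g : NCPolynomial d) {n : ℕ} (χ : ℕ → Side) (i : ℕ → Fin d)
    {π : Finpartition (Finset.univ : Finset (Fin n))} {V : Finset (Fin n)} (hV : V ∈ π.parts)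
    (hne : V.Nonempty) :
    cumulantCoeff f g V.card (LRCumulant.restrict (fun k : Fin n => χ k) V)
        (LRCumulant.restrict (fun k : Fin n => i k) V) =
      sideCoeff f g (χ (V.max' hne))
        (((χ (V.max' hne)).read ((timeList χ (V.max' hne + 1)).filter
          fun x => blockMax π x = V.max' hne)).reverse.map i) := by
  have hc : 0 < V.card := Finset.card_pos.2 hne
  have hlast : LRCumulant.restrict (fun k : Fin n => χ k) V
      ⟨V.card - 1, Nat.sub_lt hc Nat.one_pos⟩ = χ (V.max' hne) := by
    rw [LRCumulant.restrict, Finset.orderEmbOfFin_last rfl hc]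
  rw [cumulantCoeff, dif_pos hc, hlast, ← map_cumulantWord_restrict χ hV hne, List.map_map]
  rfl

/-- A block corresponds to its maximum. The other times remove nothing and contribute the
coefficient `1` of the empty word. -/
theorem prod_cumulantCoeff (f g : NCPolynomial d) {n : ℕ} (χ : ℕ → Side) (i : ℕ → Fin d)
    {π : Finpartition (Finset.univ : Finset (Fin n))} (hπ : IsBlockTag χ n (blockMax π)) :
    ∏ V ∈ π.parts, cumulantCoeff f g V.card (LRCumulant.restrict (fun k : Fin n => χ k) V)
        (LRCumulant.restrict (fun k : Fin n => i k) V) =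
      ∏ s ∈ Finset.range n,
        sideCoeff f g (χ s) ((removed χ (blockMoves χ π) s).reverse.map i) := by
  classical
  have hne : ∀ V ∈ π.parts, V.Nonempty := fun V hV => π.nonempty_of_mem_parts hV
  refine Finset.prod_of_injOn
    (fun V => if h : V.Nonempty then ((V.max' h : Fin n) : ℕ) else 0) ?_ ?_ ?_ ?_
  · intro V hV W hW hVW
    simp only [dif_pos (hne V hV), dif_pos (hne W hW)] at hVW
    have := V.max'_mem (hne V hV)
    rw [Fin.ext hVW] at this
    exact π.eq_of_mem_parts hV hW this (W.max'_mem (hne W hW))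
  · intro V hV
    simp only [dif_pos (hne V hV), Finset.coe_range, Set.mem_Iio]
    exact Fin.isLt _
  · intro s hs hs'
    rw [Finset.mem_range] at hs
    rw [removed_blockMoves hπ hs]
    have : (timeList χ (s + 1)).filter (fun x => blockMax π x = s) = [] := by
      rw [List.filter_eq_nil_iff]
      intro x hx hxs
      rw [mem_timeList] at hx
      have hxn : x < n := by omega
      have hpart := π.part_mem.2 (Finset.mem_univ (⟨x, hxn⟩ : Fin n))
      refine hs' ⟨π.part ⟨x, hxn⟩, hpart, ?_⟩
      simp only [dif_pos (hne _ hpart)]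
      rw [← blockMax_val]
      simpa using hxs
    rw [this]
    simp [sideCoeff_nil]
  · intro V hV
    rw [cumulantCoeff_restrict f g χ i hV (hne V hV)]
    simp only [dif_pos (hne V hV)]
    rw [removed_blockMoves hπ (Fin.isLt _)]

/-- The joint moments of the canonical operators. -/
theorem vacuumState_prod_canonical (f g : NCPolynomial d) (hf : ncCoeff f [] = 0)
    (hg : ncCoeff g [] = 0) (n : ℕ) (χ : ℕ → Side) (i : ℕ → Fin d) :
    vacuumState d (List.ofFn fun k : Fin n => canonical e f g (i k) (χ k)).prod =
      ∑ π ∈ Deque.partitions (fun k : Fin n => χ k), ∏ V ∈ π.parts,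
        cumulantCoeff f g V.card (LRCumulant.restrict (fun k : Fin n => χ k) V)
          (LRCumulant.restrict (fun k : Fin n => i k) V) := by
  classical
  have h1 : List.ofFn (fun k : Fin n => canonical e f g (i k) (χ k)) =
      (List.range n).map fun s => canonical e f g (i s) (χ s) := by
    rw [List.ofFn_eq_map, ← List.map_coe_finRange_eq_range, List.map_map]
    rfl
  rw [h1]
  refine (inner_vacuum_prod_canonical e f g hf hg χ i n []).trans ?_
  simp only [List.map_eq_nil_iff]
  rw [← Finset.sum_filter]
  symm
  refine Finset.sum_bij (fun π _ => blockMoves χ π) ?_ ?_ ?_ ?_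
  · intro π hπ
    rw [mem_partitions_iff] at hπ
    exact Finset.mem_filter.2 ⟨blockMoves_mem_admissible hπ, queue_blockMoves hπ⟩
  · intro π hπ π' hπ' h
    rw [mem_partitions_iff] at hπ hπ'
    exact blockMoves_injective hπ hπ' h
  · intro p hp
    obtain ⟨hp, hq⟩ := Finset.mem_filter.1 hp
    obtain ⟨π, hπ, h⟩ := exists_blockMoves_eq hp hq
    exact ⟨π, mem_partitions_iff.2 hπ, h⟩
  · intro π hπ
    exact prod_cumulantCoeff f g χ i (mem_partitions_iff.1 hπ)

/-- This is the analogue of `LRCumulant.sum_partitions_eq` for `cumulantCoeff`, which is a function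
of indices and not a multilinear functional on operators. -/
theorem sum_partitions_cumulantCoeff (f g : NCPolynomial d) {n : ℕ} (hn : 1 ≤ n)
    (χ : Fin n → Side) (i : Fin n → Fin d) :
    ∑ π ∈ Deque.partitions χ, ∏ V ∈ π.parts,
        cumulantCoeff f g V.card (LRCumulant.restrict χ V) (LRCumulant.restrict i V) =
      cumulantCoeff f g n χ i +
        ∑ π ∈ (Deque.partitions χ).filter (fun π => π.parts ≠ {Finset.univ}), ∏ V ∈ π.parts,
          cumulantCoeff f g V.card (LRCumulant.restrict χ V) (LRCumulant.restrict i V) := by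
  classical
  obtain ⟨π₁, h1, h2⟩ := LRCumulant.exists_oneBlock_mem hn χ
  rw [← Finset.sum_filter_add_sum_filter_not _ (fun π => π.parts = {Finset.univ})]
  congr 1
  have : (Deque.partitions χ).filter (fun π => π.parts = {Finset.univ}) = {π₁} := by
    ext π
    rw [Finset.mem_filter, Finset.mem_singleton]
    constructor
    · exact fun h => Finpartition.ext (h.2.trans h2.symm)
    · rintro rfl
      exact ⟨h1, h2⟩
  rw [this, Finset.sum_singleton, h2, Finset.prod_singleton]
  exact LRCumulant.family_univ (cumulantCoeff f g) χ i

/-- A restricted tuple of canonical operators is again one, so the recursion for cumulants closes up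
on such tuples and has the same solution as the one for the coefficients. -/
theorem cumulant_canonical (f g : NCPolynomial d) (hf : ncCoeff f [] = 0) (hg : ncCoeff g [] = 0)
    (n : ℕ) (hn : 1 ≤ n) (χ : Fin n → Side) (i : Fin n → Fin d) :
    LRCumulant.cumulant (vacuumState d) n χ (fun k => canonical e f g (i k) (χ k)) =
      cumulantCoeff f g n χ i := by
  induction n using Nat.strong_induction_on with
  | _ n ih =>
    obtain ⟨χ, rfl⟩ : ∃ χ' : ℕ → Side, (fun k : Fin n => χ' k) = χ :=
      ⟨fun k => if h : k < n then χ ⟨k, h⟩ else Side.left, by funext k; simp⟩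
    obtain ⟨i, rfl⟩ : ∃ i' : ℕ → Fin d, (fun k : Fin n => i' k) = i :=
      ⟨fun k => if h : k < n then i ⟨k, h⟩ else i ⟨0, hn⟩, by funext k; simp⟩
    rw [LRCumulant.cumulant_apply, vacuumState_prod_canonical e f g hf hg,
      sum_partitions_cumulantCoeff f g hn, sub_eq_iff_eq_add, add_right_inj]
    refine Finset.sum_congr rfl fun π hπ => Finset.prod_congr rfl fun V hV => ?_
    exact (ih V.card (LRCumulant.card_lt_of_mem_parts (Finset.mem_filter.1 hπ).2 hV)
      (Finset.card_pos.2 (π.nonempty_of_mem_parts hV)) _ _).symm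

end Fock

theorem occurrences_ne_nil {n : ℕ} (χ : Fin n → Side) (k : Fin n) : occurrences χ (χ k) ≠ [] :=
  List.ne_nil_of_mem (a := k) (by simp [occurrences])

/-- The index `n + 1` is the length of the tuples, which is at least `1`. -/
theorem theorem6p5 {d : ℕ} (e : OrthonormalBasis (Fin d) ℂ (EuclideanSpace ℂ (Fin d)))
    (f g : Fock.NCPolynomial d) (hf : Fock.ncCoeff f [] = 0) (hg : Fock.ncCoeff g [] = 0)
    (n : ℕ) (χ : Fin (n + 1) → Side) (i : Fin (n + 1) → Fin d) :
    (χ (Fin.last n) = Side.left →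
      LRCumulant.cumulant (Fock.vacuumState d) (n + 1) χ
          (fun k => Fock.canonical e f g (i k) (χ k)) =
        Fock.ncCoeff f
          (((occurrences χ Side.right).reverse ++ occurrences χ Side.left).map i)) ∧
    (χ (Fin.last n) = Side.right →
      LRCumulant.cumulant (Fock.vacuumState d) (n + 1) χ
          (fun k => Fock.canonical e f g (i k) (χ k)) =
        Fock.ncCoeff g
          (((occurrences χ Side.left).reverse ++ occurrences χ Side.right).map i)) := by
  have key := Fock.cumulant_canonical e f g hf hg (n + 1) (Nat.le_add_left 1 n) χ i
  have hlast : (⟨n + 1 - 1, Nat.sub_lt n.succ_pos Nat.one_pos⟩ : Fin (n + 1)) = Fin.last n := rfl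
  -- The last position occurs in the word, so the word is nonempty and the coefficient of `1 + f` or
  -- `1 + g` is that of `f` or `g`.
  have hocc := occurrences_ne_nil χ (Fin.last n)
  rw [Fock.cumulantCoeff, dif_pos n.succ_pos, hlast] at key
  constructor <;> intro h <;> rw [h] at key hocc <;> rw [key]
  · exact if_neg (by simp [cumulantWord, hocc])
  · exact if_neg (by simp [cumulantWord, hocc])
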